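/- Let $J=\operatorname{diag}(1,-1)$, $U(1,1)=\{A\in GL(2,\mathbb C): A^*JA=J\}$ and $\langle z,w\rangle_1=z_1\overline{w_1}-z_2\overline{w_2}$ on $\mathbb C^2$. For a finite subgroup $\Gamma\subset U(1,1)$ put $$\Phi_\Gamma(z,\bar z)=1-\prod_{\gamma\in\Gamma}\bigl(1-\langle\gamma z,z\rangle_1\bigr)=\sum_{\alpha,\beta}C_{\alpha\beta}\,z^\alpha\bar z^\beta .$$ Diagonalizing the Hermitian matrix $(C_{\alpha\beta})$ gives $\Phi_\Gamma=\|F\|^2-\|G\|^2$ with linearly independent holomorphic polynomial components; let $N^+(\Gamma)$ and $N^-(\Gamma)$ be the numbers of components of $F$ and $G$, that is, the numbers of positive and of negative eigenvalues, counted with multiplicity, of $(C_{\alpha\beta})$, and let $N(\Gamma)=N^+(\Gamma)+N^-(\Gamma)$. Let $0\le q_1\le q_2$ be fixed coprime integers and, for $p\geq 1$, let $\Gamma_{p;q_1,q_2}\subset U(1,1)$ be the cyclic subgroup (of order $p$) generated by $\operatorname{diag}(\omega^{q_1},\omega^{q_2})$, where $\omega$ is a primitive $p$-th root of unity. Then $$\lim_{p\to\infty}\frac{N^+(\Gamma_{p;q_1,q_2})}{N(\Gamma_{p;q_1,q_2})}=\begin{cases}\dfrac{q_1q_2+1}{4q_1q_2}&\text{if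 }q_1\text{ and }q_2\text{ are odd},\\[2ex]\dfrac{q_1(q_2-q_1)+1}{4q_1(q_2-q_1)}&\text{if }q_1\text{ is odd and }q_2\text{ is even}.\end{cases}$$ If $q_1$ is even and $q_2$ is odd, then along odd orders and along even orders respectively $$\lim_{n\to\infty}\frac{N^+(\Gamma_{2n+1;q_1,q_2})}{N(\Gamma_{2n+1;q_1,q_2})}=\frac{q_2(q_2-q_1)+1}{4q_2(q_2-q_1)},\qquad \lim_{n\to\infty}\frac{N^+(\Gamma_{2n;q_1,q_2})}{N(\Gamma_{2n;q_1,q_2})}=\frac{3q_2(q_2-q_1)-1}{4q_2(q_2-q_1)} .$$ -/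

import Mathlib

open Filter Topology

noncomputable section

namespace HyperquadricCR

open MvPolynomial

/-- The matrix `J = diag(1, -1)` of the Hermitian form of signature `(1, 1)`. -/
def J : Matrix (Fin 2) (Fin 2) ℂ := Matrix.diagonal ![1, -1]

/-- The indefinite unitary group `U(1,1) = {A ∈ GL(2, ℂ) : A* J A = J}`. -/
def U11 : Subgroup (GL (Fin 2) ℂ) where
  carrier := {A | (A : Matrix (Fin 2) (Fin 2) ℂ).conjTranspose * J * A = J}
  one_mem' := by simp
  mul_mem' := by
    intro A B hA hB
    simp only [Set.mem_ofPred_eq] at hA hB ⊢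
    calc ((A * B : GL (Fin 2) ℂ) : Matrix (Fin 2) (Fin 2) ℂ).conjTranspose * J
          * ((A * B : GL (Fin 2) ℂ) : Matrix (Fin 2) (Fin 2) ℂ)
        = (B : Matrix (Fin 2) (Fin 2) ℂ).conjTranspose *
            ((A : Matrix (Fin 2) (Fin 2) ℂ).conjTranspose * J * A) * B := by
          simp [Matrix.conjTranspose_mul, Matrix.mul_assoc]
      _ = J := by rw [hA, hB]
  inv_mem' := by
    intro A hA
    simp only [Set.mem_ofPred_eq] at hA ⊢
    have h1 : (A : Matrix (Fin 2) (Fin 2) ℂ) * ((A⁻¹ : GL (Fin 2) ℂ) : Matrix (Fin 2) (Fin 2) ℂ)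
        = 1 := by
      rw [← Units.val_mul]; simp
    have h2 : ((A⁻¹ : GL (Fin 2) ℂ) : Matrix (Fin 2) (Fin 2) ℂ).conjTranspose *
        (A : Matrix (Fin 2) (Fin 2) ℂ).conjTranspose = 1 := by
      rw [← Matrix.conjTranspose_mul, h1, Matrix.conjTranspose_one]
    calc ((A⁻¹ : GL (Fin 2) ℂ) : Matrix (Fin 2) (Fin 2) ℂ).conjTranspose * J
          * ((A⁻¹ : GL (Fin 2) ℂ) : Matrix (Fin 2) (Fin 2) ℂ)
        = ((A⁻¹ : GL (Fin 2) ℂ) : Matrix (Fin 2) (Fin 2) ℂ).conjTranspose *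
            ((A : Matrix (Fin 2) (Fin 2) ℂ).conjTranspose * J * A) *
            ((A⁻¹ : GL (Fin 2) ℂ) : Matrix (Fin 2) (Fin 2) ℂ) := by rw [hA]
      _ = (((A⁻¹ : GL (Fin 2) ℂ) : Matrix (Fin 2) (Fin 2) ℂ).conjTranspose *
            (A : Matrix (Fin 2) (Fin 2) ℂ).conjTranspose) * J * ((A : Matrix (Fin 2) (Fin 2) ℂ) *
            ((A⁻¹ : GL (Fin 2) ℂ) : Matrix (Fin 2) (Fin 2) ℂ)) := by
          simp only [Matrix.mul_assoc]
      _ = J := by rw [h1, h2, Matrix.one_mul, Matrix.mul_one]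

/-- The matrix `diag(u, v)` with `|u| = |v| = 1`, as an element of `GL(2, ℂ)`. -/
def diagGL (u v : Circle) : GL (Fin 2) ℂ where
  val := Matrix.diagonal ![(u : ℂ), (v : ℂ)]
  inv := Matrix.diagonal ![((u⁻¹ : Circle) : ℂ), ((v⁻¹ : Circle) : ℂ)]
  val_inv := by
    rw [Matrix.diagonal_mul_diagonal, ← Matrix.diagonal_one]
    congr 1; funext i; fin_cases i <;> simp
  inv_val := by
    rw [Matrix.diagonal_mul_diagonal, ← Matrix.diagonal_one]
    congr 1; funext i; fin_cases i <;> simp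

theorem diagGL_mem_U11 (u v : Circle) : diagGL u v ∈ U11 := by
  have hu : (starRingEnd ℂ) (u : ℂ) * u = 1 := by
    rw [← Complex.normSq_eq_conj_mul_self, Circle.normSq_coe]; simp
  have hv : (starRingEnd ℂ) (v : ℂ) * v = 1 := by
    rw [← Complex.normSq_eq_conj_mul_self, Circle.normSq_coe]; simp
  change (Matrix.diagonal ![(u : ℂ), (v : ℂ)]).conjTranspose * J *
    Matrix.diagonal ![(u : ℂ), (v : ℂ)] = J
  rw [Matrix.diagonal_conjTranspose, J, Matrix.diagonal_mul_diagonal,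
    Matrix.diagonal_mul_diagonal]
  congr 1; funext i; fin_cases i <;> simp [hu, hv]

/-- The cyclic subgroup of `U(1,1)` generated by `diag(ω ^ q₁, ω ^ q₂)`. For `ω` a primitive
`p`-th root of unity this is `Γ_{p;q₁,q₂}`. -/
def Gam (ω : Circle) (q₁ q₂ : ℕ) : Subgroup U11 :=
  Subgroup.zpowers ⟨diagGL (ω ^ q₁) (ω ^ q₂), diagGL_mem_U11 _ _⟩

/-- `⟨γ z, z⟩₁ = (γ z)₁ z̄₁ - (γ z)₂ z̄₂` as a polynomial in `z` and `z̄`. The variable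
`Sum.inl j` stands for `z_j` and the variable `Sum.inr i` for the conjugate of `z_i`. -/
def pairing (γ : U11) : MvPolynomial (Fin 2 ⊕ Fin 2) ℂ :=
  ∑ i : Fin 2, ∑ j : Fin 2,
    C (J i i * ((γ : GL (Fin 2) ℂ) : Matrix (Fin 2) (Fin 2) ℂ) i j)
      * X (Sum.inl j) * X (Sum.inr i)

/-- The invariant Hermitian polynomial `Φ_Γ(z, z̄) = 1 - ∏_{γ ∈ Γ} (1 - ⟨γ z, z⟩₁)` of a finite
subgroup `Γ` of `U(1,1)`. -/
def Phi (Γ : Subgroup U11) : MvPolynomial (Fin 2 ⊕ Fin 2) ℂ :=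
  1 - ∏ᶠ γ : Γ, (1 - pairing (γ : U11))

/-- The monomial `z ^ α z̄ ^ β` as an exponent vector. -/
def biExponent (α β : Fin 2 → ℕ) : Fin 2 ⊕ Fin 2 →₀ ℕ :=
  Finsupp.equivFunOnFinite.symm (Sum.elim α β)

/-- The matrix of coefficients `C_{αβ}` of `P = ∑ C_{αβ} z ^ α z̄ ^ β`. The index set consists of
all exponents with entries at most the total degree of `P`; thus every monomial of `P` is
recorded, and the remaining entries are zero. -/
def coeffMatrix (P : MvPolynomial (Fin 2 ⊕ Fin 2) ℂ) :
    Matrix (Fin 2 → Fin (P.totalDegree + 1)) (Fin 2 → Fin (P.totalDegree + 1)) ℂ :=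
  fun α β => P.coeff (biExponent (fun i => (α i : ℕ)) (fun i => (β i : ℕ)))

/-- The number of positive eigenvalues, with multiplicity, of a Hermitian matrix (all of whose
eigenvalues are real). -/
def numPos {ι : Type} [Fintype ι] [DecidableEq ι] (M : Matrix ι ι ℂ) : ℕ :=
  M.charpoly.roots.countP (fun μ => 0 < μ.re)

/-- The number of negative eigenvalues, with multiplicity, of a Hermitian matrix (all of whose
eigenvalues are real). -/
def numNeg {ι : Type} [Fintype ι] [DecidableEq ι] (M : Matrix ι ι ℂ) : ℕ :=
  M.charpoly.roots.countP (fun μ => μ.re < 0)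

/-- `N⁺(Γ)`: the number of squared norms with a plus sign when the Hermitian matrix of
coefficients of `Φ_Γ` is diagonalized, `Φ_Γ = ‖F‖² - ‖G‖²`. -/
def Npos (Γ : Subgroup U11) : ℕ := numPos (coeffMatrix (Phi Γ))

/-- `N⁻(Γ)`: the number of squared norms with a minus sign. -/
def Nneg (Γ : Subgroup U11) : ℕ := numNeg (coeffMatrix (Phi Γ))

/-- The positivity ratio `N⁺(Γ) / N(Γ)`, where `N(Γ) = N⁺(Γ) + N⁻(Γ)`. -/
def positivityRatio (Γ : Subgroup U11) : ℝ := (Npos Γ : ℝ) / ((Npos Γ + Nneg Γ : ℕ) : ℝ)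

end HyperquadricCR

end

/-! Put x = |z₁|², y = |z₂|². Coprimality gives the group p elements, and 1 - Φ = ∏_l (1 - ω^(q₁l) x
+ ω^(q₂l) y) is the determinant of the circulant I - x S^q₁ + y S^q₂, with S the cyclic shift of
ZMod p. Up to the factor (-1)^r, its coefficient at x^r y^s is the sum of the signs of the
permutations i ↦ i + q(τ i) with r steps q₁, s steps q₂ and the other steps 0. In particular the
Hermitian matrix is diagonal, and only signs of coefficients matter.

Such permutations exist exactly when r + s ≤ p and q₁r + q₂s = kp for some k
(`exists_injective_shiftMap`, `dvd_of_injective`). For q₂ < p they all have the same sign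
(`sign_eq_of_shiftMap`), so nothing cancels. View each step as an arc on the circle: the inversion
parity is the number of nested pairs of arcs plus (p+1)k. Arcs over fixed points number k for each
fixed point. Long arcs over short ones are counted modulo 2 by writing both indicator functions as
moving sums of one function h (`exists_height`), after which a reflection symmetry evaluates the
correlation (`sum_nested_arcs_eq`).

The result (`hermCoeff_sign`): away from the origin, the coefficient of Φ is positive iff s is even
and r or k is odd. It remains to count lattice points on the q₂ + 1 segments q₁r + q₂s = kp of the
triangle. Congruences cut out a residue class of r modulo q₂ or 2q₂, so each count is asymptotically
linear in p, with slope given by `segmentLength`. Summing over k with parity weights gives the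
limits. -/

namespace HyperquadricCR

open MvPolynomial

/-! ### The circulant determinant and its expansion. -/

/-- The map `i ↦ i + q (τ i)` on `ZMod p`, with `q = (0, q₁, q₂)`. -/
def shiftMap (p q₁ q₂ : ℕ) (τ : ZMod p → Fin 3) (i : ZMod p) : ZMod p :=
  i + ((![0, q₁, q₂] (τ i) : ℕ) : ZMod p)

/-- The determinant of the matrix of `shiftMap`: the sign of that map if it is a permutation,
and zero otherwise. -/
def shiftSign (p q₁ q₂ : ℕ) [NeZero p] (τ : ZMod p → Fin 3) : ℤ :=
  Matrix.det (Matrix.of fun i => (Pi.single (shiftMap p q₁ q₂ τ i) 1 : ZMod p → ℤ))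

theorem shiftSign_eq_zero {p q₁ q₂ : ℕ} [NeZero p] {τ : ZMod p → Fin 3}
    (h : ¬ Function.Injective (shiftMap p q₁ q₂ τ)) : shiftSign p q₁ q₂ τ = 0 := by
  rw [Function.not_injective_iff] at h
  obtain ⟨i, j, hij, hne⟩ := h
  refine Matrix.det_zero_of_row_eq hne ?_
  funext k
  simp [hij]

theorem shiftSign_eq_sign {p q₁ q₂ : ℕ} [NeZero p] {τ : ZMod p → Fin 3}
    (σ : Equiv.Perm (ZMod p)) (h : ∀ i, σ i = shiftMap p q₁ q₂ τ i) :
    shiftSign p q₁ q₂ τ = Equiv.Perm.sign σ := by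
  have h' := Matrix.det_permutation (R := ℤ) σ
  rw [Int.cast_id] at h'
  rw [shiftSign, ← h']
  congr 1
  ext i j
  rw [Matrix.of_apply, ← h i, Equiv.Perm.permMatrix, PEquiv.toMatrix_apply]
  simp [Pi.single_apply, eq_comm]

/-- Multilinearity in the rows: choosing one summand in every row is choosing τ. -/
theorem det_sum_smul_shift {R : Type*} [CommRing R] (p q₁ q₂ : ℕ) [NeZero p] (c : Fin 3 → R) :
    Matrix.det (Matrix.of fun i : ZMod p => ∑ t : Fin 3,
      c t • (Pi.single (i + ((![0, q₁, q₂] t : ℕ) : ZMod p)) 1 : ZMod p → R)) =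
    ∑ τ : ZMod p → Fin 3, (∏ i, c (τ i)) * (shiftSign p q₁ q₂ τ : R) := by
  have h := MultilinearMap.map_sum (R := R)
    (Matrix.detRowAlternating (n := ZMod p) (R := R)).toMultilinearMap
    (fun (i : ZMod p) (t : Fin 3) =>
      c t • (Pi.single (i + ((![0, q₁, q₂] t : ℕ) : ZMod p)) 1 : ZMod p → R))
  refine h.trans (Finset.sum_congr rfl fun τ _ => ?_)
  rw [MultilinearMap.map_smul_univ, smul_eq_mul]
  congr 1
  have h2 := RingHom.map_det (Int.castRingHom R)
    (Matrix.of fun i => (Pi.single (shiftMap p q₁ q₂ τ i) 1 : ZMod p → ℤ))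
  rw [shiftSign]
  refine Eq.trans ?_ h2.symm
  change Matrix.det _ = _
  congr 1
  ext i j
  simp [Pi.single_apply, shiftMap]

/-- The Fourier matrix `V` diagonalizes every circulant. Over a domain of characteristic zero it
suffices that `V * V'` is p times the identity, so that det `V` can be cancelled; `V` need not be
invertible. -/
theorem det_sum_smul_shift_eq_prod {R : Type*} [CommRing R] [IsDomain R] [CharZero R]
    (p q₁ q₂ : ℕ) [NeZero p] {ζ : R} (hζ : IsPrimitiveRoot ζ p) (c : Fin 3 → R) :
    Matrix.det (Matrix.of fun i : ZMod p => ∑ t : Fin 3,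
      c t • (Pi.single (i + ((![0, q₁, q₂] t : ℕ) : ZMod p)) 1 : ZMod p → R)) =
    ∏ l : ZMod p, ∑ t : Fin 3, c t * ζ ^ (![0, q₁, q₂] t * l.val) := by
  set χ := AddChar.zmodChar p hζ.pow_eq_one with hχ
  have hprim : χ.IsPrimitive := AddChar.zmodChar_primitive_of_primitive_root p hζ
  set M : Matrix (ZMod p) (ZMod p) R := Matrix.of fun i : ZMod p => ∑ t : Fin 3,
      c t • (Pi.single (i + ((![0, q₁, q₂] t : ℕ) : ZMod p)) 1 : ZMod p → R) with hM
  let V : Matrix (ZMod p) (ZMod p) R := Matrix.of fun i l => χ (i * l)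
  let V' : Matrix (ZMod p) (ZMod p) R := Matrix.of fun l j => χ (-(l * j))
  have hVV' : V * V' = Matrix.diagonal fun _ => (p : R) := by
    ext i j
    rw [Matrix.mul_apply, Matrix.diagonal_apply]
    have : ∀ l : ZMod p, V i l * V' l j = χ (l * (i - j)) := by
      intro l
      simp only [V, V', Matrix.of_apply]
      rw [← AddChar.map_add_eq_mul]
      congr 1; ring
    simp_rw [this]
    rw [AddChar.sum_mulShift _ hprim]
    simp [sub_eq_zero]
  have hV : V.det ≠ 0 := by
    intro h0
    have := congrArg Matrix.det hVV'
    rw [Matrix.det_mul, h0, zero_mul, Matrix.det_diagonal] at this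
    have hp : (p : R) ≠ 0 := by exact_mod_cast NeZero.ne p
    exact (Finset.prod_ne_zero_iff.2 fun _ _ => hp) this.symm
  have hMV : M * V = V * Matrix.diagonal fun l : ZMod p =>
      ∑ t : Fin 3, c t * ζ ^ (![0, q₁, q₂] t * l.val) := by
    ext i l
    rw [Matrix.mul_diagonal, Matrix.mul_apply]
    simp only [hM, Matrix.of_apply, Finset.sum_apply, Pi.smul_apply, smul_eq_mul, Finset.sum_mul,
      Finset.mul_sum]
    rw [Finset.sum_comm]
    refine Finset.sum_congr rfl fun t _ => ?_
    rw [Finset.sum_eq_single (i + ((![0, q₁, q₂] t : ℕ) : ZMod p))]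
    · simp only [Pi.single_eq_same, V, Matrix.of_apply, mul_one]
      rw [add_mul, AddChar.map_add_eq_mul]
      have : χ (((![0, q₁, q₂] t : ℕ) : ZMod p) * l) = ζ ^ (![0, q₁, q₂] t * l.val) := by
        rw [← AddChar.zmodChar_apply' hζ.pow_eq_one]
        rw [Nat.cast_mul, ZMod.natCast_zmod_val]
      rw [this]; ring
    · intro j _ hj
      simp [hj]
    · simp
  have := congrArg Matrix.det hMV
  rw [Matrix.det_mul, Matrix.det_mul, Matrix.det_diagonal, mul_comm] at this
  exact mul_left_cancel₀ hV this

/-- The number of indices at which `τ` takes the value `t`. -/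
def typeCount {p : ℕ} [NeZero p] (τ : ZMod p → Fin 3) (t : Fin 3) : ℕ :=
  (Finset.univ.filter fun i => τ i = t).card

theorem prod_apply_eq_pow_typeCount {R : Type*} [CommRing R] {p : ℕ} [NeZero p]
    (τ : ZMod p → Fin 3) (c : Fin 3 → R) :
    ∏ i, c (τ i) = ∏ t, c t ^ typeCount τ t := by
  rw [← Finset.prod_fiberwise_of_maps_to (s := Finset.univ) (t := Finset.univ) (g := τ)
    (fun _ _ => Finset.mem_univ _)]
  refine Finset.prod_congr rfl fun t _ => ?_
  rw [typeCount, ← Finset.prod_const]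
  exact Finset.prod_congr rfl fun i hi => by rw [(Finset.mem_filter.1 hi).2]

/-! ### The invariant polynomial of the cyclic group as a circulant determinant. -/

theorem orderOf_generator {p q₁ q₂ : ℕ} (hcop : Nat.Coprime q₁ q₂) {ω : Circle}
    (hω : IsPrimitiveRoot ω p) :
    orderOf (⟨diagGL (ω ^ q₁) (ω ^ q₂), diagGL_mem_U11 _ _⟩ : U11) = p := by
  have hpow : ∀ n : ℕ, (diagGL (ω ^ q₁) (ω ^ q₂)) ^ n = diagGL (ω ^ (q₁ * n)) (ω ^ (q₂ * n)) := by
    intro n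
    ext1
    rw [Units.val_pow_eq_pow_val]
    change (Matrix.diagonal _) ^ n = Matrix.diagonal _
    rw [Matrix.diagonal_pow]
    congr 1; funext i; fin_cases i <;> simp [pow_mul]
  have hone : ∀ u v : Circle, diagGL u v = 1 ↔ u = 1 ∧ v = 1 := by
    intro u v
    rw [← Units.val_inj]
    change Matrix.diagonal _ = (1 : Matrix (Fin 2) (Fin 2) ℂ) ↔ _
    rw [← Matrix.diagonal_one, Matrix.diagonal_injective.eq_iff]
    simp [funext_iff, Fin.forall_fin_two, ← Circle.ext_iff, ← Circle.coe_one]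
  have key : ∀ n : ℕ, (⟨diagGL (ω ^ q₁) (ω ^ q₂), diagGL_mem_U11 _ _⟩ : U11) ^ n = 1 ↔ p ∣ n := by
    intro n
    rw [← Subtype.coe_inj]
    change (diagGL (ω ^ q₁) (ω ^ q₂)) ^ n = 1 ↔ _
    rw [hpow, hone, hω.pow_eq_one_iff_dvd, hω.pow_eq_one_iff_dvd]
    constructor
    · rintro ⟨h1, h2⟩
      have := Nat.dvd_gcd h1 h2
      rwa [Nat.gcd_mul_right, hcop.gcd_eq_one, one_mul] at this
    · exact fun h => ⟨h.mul_left _, h.mul_left _⟩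
  refine Nat.dvd_antisymm (orderOf_dvd_of_pow_eq_one ((key p).2 dvd_rfl)) ?_
  exact (key _).1 (pow_orderOf_eq_one _)

theorem pairing_generator_pow (q₁ q₂ : ℕ) (ω : Circle) (n : ℕ) :
    1 - pairing ((⟨diagGL (ω ^ q₁) (ω ^ q₂), diagGL_mem_U11 _ _⟩ : U11) ^ n) =
    ∑ t : Fin 3, (![1, -(X (Sum.inl 0) * X (Sum.inr 0)), X (Sum.inl 1) * X (Sum.inr 1)] t :
      MvPolynomial (Fin 2 ⊕ Fin 2) ℂ) * (C (ω : ℂ)) ^ (![0, q₁, q₂] t * n) := by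
  have hpow : ((((⟨diagGL (ω ^ q₁) (ω ^ q₂), diagGL_mem_U11 _ _⟩ : U11) ^ n : U11) :
      GL (Fin 2) ℂ) : Matrix (Fin 2) (Fin 2) ℂ) =
      Matrix.diagonal ![(ω : ℂ) ^ (q₁ * n), (ω : ℂ) ^ (q₂ * n)] := by
    rw [Subgroup.coe_pow, Units.val_pow_eq_pow_val]
    change (Matrix.diagonal _) ^ n = Matrix.diagonal _
    rw [Matrix.diagonal_pow]
    congr 1; funext i; fin_cases i <;> simp [pow_mul]
  rw [pairing, hpow]
  simp [Fin.sum_univ_two, Fin.sum_univ_three, J, map_pow]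
  ring

/-- `1 - Φ_Γ` as a sum over the maps `τ : ZMod p → {0, 1, 2}`. -/
theorem Phi_Gam_eq {p q₁ q₂ : ℕ} [NeZero p] (hcop : Nat.Coprime q₁ q₂) {ω : Circle}
    (hω : IsPrimitiveRoot ω p) :
    Phi (Gam ω q₁ q₂) = 1 - ∑ τ : ZMod p → Fin 3,
      ((-(X (Sum.inl 0) * X (Sum.inr 0))) ^ typeCount τ 1 *
        (X (Sum.inl 1) * X (Sum.inr 1)) ^ typeCount τ 2) * (shiftSign p q₁ q₂ τ : MvPolynomial (Fin 2 ⊕ Fin 2) ℂ) := by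
  have hfin : IsOfFinOrder (⟨diagGL (ω ^ q₁) (ω ^ q₂), diagGL_mem_U11 _ _⟩ : U11) := by
    rw [← orderOf_pos_iff, orderOf_generator hcop hω]
    exact NeZero.pos p
  have hζ : IsPrimitiveRoot (C (ω : ℂ) : MvPolynomial (Fin 2 ⊕ Fin 2) ℂ) p := by
    have h1 : IsPrimitiveRoot (ω : ℂ) p :=
      hω.map_of_injective (f := Circle.coeHom) Circle.coe_injective
    exact h1.map_of_injective (C_injective _ _)
  rw [Phi]
  congr 1
  have hprod : ∏ᶠ γ : Gam ω q₁ q₂, (1 - pairing (γ : U11)) =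
      ∏ l : ZMod p, (1 - pairing ((⟨diagGL (ω ^ q₁) (ω ^ q₂), diagGL_mem_U11 _ _⟩ : U11) ^ l.val)) := by
    rw [← finprod_eq_prod_of_fintype]
    symm
    refine finprod_eq_of_bijective (fun l : ZMod p =>
      (⟨(⟨diagGL (ω ^ q₁) (ω ^ q₂), diagGL_mem_U11 _ _⟩ : U11) ^ l.val,
        Subgroup.npow_mem_zpowers _ _⟩ : Gam ω q₁ q₂)) ⟨?_, ?_⟩ (fun _ => rfl)
    · intro a b hab
      have hab' := congrArg Subtype.val hab
      have := pow_injOn_Iio_orderOf (by simpa [orderOf_generator hcop hω] using ZMod.val_lt a)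
        (by simpa [orderOf_generator hcop hω] using ZMod.val_lt b) hab'
      exact ZMod.val_injective p this
    · rintro ⟨γ, hγ⟩
      obtain ⟨n, hn⟩ := (hfin.mem_zpowers_iff_mem_range_orderOf).1 hγ |> Finset.mem_image.1
      refine ⟨(n : ZMod p), Subtype.ext ?_⟩
      have hlt : n < p := by
        have := Finset.mem_range.1 hn.1
        rwa [orderOf_generator hcop hω] at this
      change _ ^ ((n : ZMod p).val) = γ
      rw [ZMod.val_natCast_of_lt hlt]
      exact hn.2
  rw [hprod]
  simp_rw [pairing_generator_pow]
  rw [← det_sum_smul_shift_eq_prod p q₁ q₂ hζ, det_sum_smul_shift]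
  refine Finset.sum_congr rfl fun τ _ => ?_
  rw [prod_apply_eq_pow_typeCount, Fin.prod_univ_three]
  simp

theorem coeff_Phi_Gam {p q₁ q₂ : ℕ} [NeZero p] (hcop : Nat.Coprime q₁ q₂) {ω : Circle}
    (hω : IsPrimitiveRoot ω p) (α β : Fin 2 → ℕ) :
    (Phi (Gam ω q₁ q₂)).coeff (biExponent α β) =
      (((if α = 0 ∧ β = 0 then 1 else 0) - ∑ τ : ZMod p → Fin 3,
        if α = ![typeCount τ 1, typeCount τ 2] ∧ β = α
          then (-1) ^ α 0 * shiftSign p q₁ q₂ τ else 0 : ℤ) : ℂ) := by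
  have hbi : ∀ α β α' β', biExponent α β = biExponent α' β' ↔ α = α' ∧ β = β' := by
    intro α β α' β'
    rw [biExponent, biExponent, Finsupp.equivFunOnFinite.symm.injective.eq_iff]
    constructor
    · intro h
      exact ⟨funext fun i => congrFun h (Sum.inl i), funext fun i => congrFun h (Sum.inr i)⟩
    · rintro ⟨rfl, rfl⟩; rfl
  have hzero : (0 : Fin 2 ⊕ Fin 2 →₀ ℕ) = biExponent 0 0 := by
    ext i; rcases i with i | i <;> simp [biExponent]
  have hmono : ∀ r s : ℕ, ∀ n : ℤ, ((-(X (Sum.inl 0) * X (Sum.inr 0))) ^ r *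
        (X (Sum.inl 1) * X (Sum.inr 1)) ^ s) * (n : MvPolynomial (Fin 2 ⊕ Fin 2) ℂ) =
      monomial (biExponent ![r, s] ![r, s]) (((-1) ^ r * n : ℤ) : ℂ) := by
    intro r s n
    have h1 : (monomial (biExponent ![r, s] ![r, s]) (((-1) ^ r * n : ℤ) : ℂ)) =
      C (((-1) ^ r * n : ℤ) : ℂ) * monomial (biExponent ![r, s] ![r, s]) 1 := by
      rw [C_mul_monomial, mul_one]
    rw [h1, monomial_eq, Finsupp.prod_fintype _ _ (by simp), Fintype.prod_sum_type]
    simp [biExponent, Fin.prod_univ_two]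
    ring
  rw [Phi_Gam_eq hcop hω, coeff_sub, coeff_sum, coeff_one, hzero]
  simp_rw [hmono, coeff_monomial, hbi]
  push_cast
  congr 1
  · congr 1
    simp [eq_comm]
  · refine Finset.sum_congr rfl fun τ _ => ?_
    by_cases h : ![typeCount τ 1, typeCount τ 2] = α
    · subst h
      simp [eq_comm]
    · rw [if_neg (fun h' => h h'.1), if_neg (fun h' => h h'.1.symm)]

/-! ### Reindexing sums over ZMod p. -/

section Sums

theorem sum_zmod_eq_sum_range {M : Type*} [AddCommMonoid M] {p : ℕ} [NeZero p] (F : ZMod p → M) :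
    ∑ e, F e = ∑ d ∈ Finset.range p, F d := by
  refine Finset.sum_nbij' (fun e => e.val) (fun d => (d : ZMod p)) ?_ ?_ ?_ ?_ ?_
  · intro e _; simpa using ZMod.val_lt e
  · intro d _; simp
  · intro e _; simp
  · intro d hd; exact ZMod.val_natCast_of_lt (Finset.mem_range.1 hd)
  · intro e _; simp

theorem sum_zmod_ite_val_lt {M : Type*} [AddCommMonoid M] {p : ℕ} [NeZero p] {q : ℕ} (hq : q ≤ p)
    (F : ZMod p → M) :
    ∑ e, (if e.val < q then F e else 0) = ∑ d ∈ Finset.range q, F d := by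
  rw [sum_zmod_eq_sum_range]
  rw [← Finset.sum_subset (Finset.range_subset_range.2 hq)]
  · refine Finset.sum_congr rfl fun d hd => ?_
    rw [Finset.mem_range] at hd
    rw [ZMod.val_natCast_of_lt (hd.trans_le hq), if_pos hd]
  · intro d hd hd'
    rw [Finset.mem_range] at hd hd'
    rw [ZMod.val_natCast_of_lt hd, if_neg hd']

theorem sum_pairs_eq {M : Type*} [AddCommGroup M] {p : ℕ} [NeZero p] (F : ZMod p → ZMod p → M) :
    ∑ i, ∑ j, (if i.val < j.val then F i j + F j i else 0) = ∑ i, ∑ j, F i j - ∑ i, F i i := by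
  have h1 : ∀ i j : ZMod p, F i j = (if i.val < j.val then F i j else 0) +
      (if j.val < i.val then F i j else 0) + (if i = j then F i j else 0) := by
    intro i j
    rcases lt_trichotomy i.val j.val with h | h | h
    · have : i ≠ j := by rintro rfl; exact lt_irrefl _ h
      simp [h, this, h.le]
    · have : i = j := ZMod.val_injective p h
      simp [this]
    · have : i ≠ j := by rintro rfl; exact lt_irrefl _ h
      simp [h, this, h.le]
  have h2 : ∑ i, ∑ j, F i j = ∑ i, ∑ j, (if i.val < j.val then F i j else 0) +
      ∑ i, ∑ j, (if j.val < i.val then F i j else 0) + ∑ i, F i i := by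
    conv_lhs => enter [2, i, 2, j]; rw [h1 i j]
    simp [Finset.sum_add_distrib]
  rw [h2, add_sub_cancel_right]
  conv_rhs => enter [2]; rw [Finset.sum_comm]
  rw [← Finset.sum_add_distrib]
  refine Finset.sum_congr rfl fun i _ => ?_
  rw [← Finset.sum_add_distrib]
  refine Finset.sum_congr rfl fun j _ => ?_
  split_ifs <;> simp

end Sums

/-! ### Inversion parity and nested arcs. -/

section Inversions

theorem sign_fin_eq_pow_inversions {n : ℕ} (σ : Equiv.Perm (Fin n)) :
    Equiv.Perm.sign σ = (-1) ^ (∑ i, ∑ j, if i < j ∧ σ j < σ i then 1 else 0 : ℕ) := by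
  rw [Equiv.Perm.sign_eq_prod_prod_Ioi, ← Finset.prod_pow_eq_pow_sum]
  refine Finset.prod_congr rfl fun i _ => ?_
  rw [← Finset.prod_pow_eq_pow_sum]
  have : Finset.Ioi i = Finset.univ.filter fun j => i < j := by
    ext; simp
  rw [this, Finset.prod_filter]
  refine Finset.prod_congr rfl fun j _ => ?_
  by_cases hij : i < j
  · have hne : σ i ≠ σ j := fun h => hij.ne (σ.injective h)
    by_cases hs : σ j < σ i
    · simp [hij, hs, hs.not_gt]
    · simp [hij, hs, lt_of_le_of_ne (not_lt.1 hs) hne]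
  · simp [hij]

theorem sign_eq_pow_inversions {p : ℕ} [NeZero p] (σ : Equiv.Perm (ZMod p)) :
    Equiv.Perm.sign σ = (-1) ^ (∑ i, ∑ j,
      if i.val < j.val ∧ (σ j).val < (σ i).val then 1 else 0 : ℕ) := by
  obtain _ | n := p
  · exact absurd rfl (NeZero.ne 0)
  · exact sign_fin_eq_pow_inversions (n := n + 1) σ

/-- The inversion number modulo two of a permutation `σ i = i + δ i` of `ZMod p` with
displacements `0 ≤ δ i < p`. -/
theorem inversions_eq {p : ℕ} [NeZero p] (σ : Equiv.Perm (ZMod p)) (δ : ZMod p → ℕ)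
    (hδ : ∀ i, δ i < p) (h : ∀ i, σ i = i + (δ i : ZMod p)) {k : ℕ} (hk : ∑ i, δ i = k * p) :
    ((∑ i, ∑ j, if i.val < j.val ∧ (σ j).val < (σ i).val then 1 else 0 : ℕ) : ZMod 2) =
      ∑ i, ∑ j, (if (j - i).val + δ j < δ i then 1 else 0) + (p + 1) * k := by
  -- `w i` records whether the arc from i wraps past 0, at most once since δ i < p. As σ permutes
  -- the residues, the total number of wraps is k.
  have hw : ∀ i, ∃ w : ℕ, w ≤ 1 ∧ i.val + δ i = (σ i).val + p * w := by
    intro i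
    have hv : (σ i).val = (i.val + δ i) % p := by
      rw [h i, ← ZMod.val_natCast]
      simp
    refine ⟨(i.val + δ i) / p, ?_, ?_⟩
    · have := ZMod.val_lt i
      have := hδ i
      exact Nat.le_of_lt_succ ((Nat.div_lt_iff_lt_mul (NeZero.pos p)).2 (by omega))
    · rw [hv, Nat.mod_add_div]
  choose w hw1 hw2 using hw
  have hwk : ∑ i, w i = k := by
    have h1 : ∑ i, (i.val + δ i) = ∑ i, ((σ i).val + p * w i) := Finset.sum_congr rfl fun i _ => hw2 i
    rw [Finset.sum_add_distrib, Finset.sum_add_distrib, Equiv.sum_comp σ (fun i => i.val),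
      ← Finset.mul_sum, hk] at h1
    have := Nat.add_left_cancel h1
    rw [mul_comm] at this
    exact (Nat.eq_of_mul_eq_mul_left (NeZero.pos p) this).symm
  -- For i before j, the pair is inverted modulo 2 according to: one arc nested in the other, plus
  -- the wraps of both. Symmetrized over pairs, the wraps contribute pk - k, that is (p+1)k modulo
  -- 2.
  let F : ZMod p → ZMod p → ZMod 2 := fun i j =>
    (if (j - i).val + δ j < δ i then 1 else 0) + (w i : ZMod 2)
  have hpair : ∀ i j : ZMod p, ((if i.val < j.val ∧ (σ j).val < (σ i).val then 1 else 0 : ℕ) : ZMod 2)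
      = if i.val < j.val then F i j + F j i else 0 := by
    intro i j
    by_cases hij : i.val < j.val
    · have hd : (j - i).val = j.val - i.val := ZMod.val_sub hij.le
      have hd' : (i - j).val = p - (j.val - i.val) := by
        have hne : NeZero (j - i) := ⟨fun h0 => by rw [sub_eq_zero] at h0; subst h0; omega⟩
        rw [← neg_sub j i, ZMod.val_neg_of_ne_zero, hd]
      have hne : (σ i).val ≠ (σ j).val := fun h0 => by
        have := σ.injective (ZMod.val_injective p h0)
        subst this; omega
      have a1 := hw2 i
      have a2 := hw2 j
      have b1 := ZMod.val_lt i
      have b2 := ZMod.val_lt j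
      have b3 := ZMod.val_lt (σ i)
      have b4 := ZMod.val_lt (σ j)
      have c1 := hδ i
      have c2 := hδ j
      simp only [F, hd, hd', hij, true_and, if_true]
      rcases Nat.le_one_iff_eq_zero_or_eq_one.1 (hw1 i) with wi | wi <;>
        rcases Nat.le_one_iff_eq_zero_or_eq_one.1 (hw1 j) with wj | wj <;>
        rw [wi] at a1 <;> rw [wj] at a2 <;> rw [wi, wj] <;> split_ifs <;>
        first
          | (exfalso; omega)
          | decide
    · simp [hij]
  rw [Nat.cast_sum]
  simp_rw [Nat.cast_sum, hpair]
  rw [sum_pairs_eq]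
  simp only [F, Finset.sum_add_distrib, sub_self, ZMod.val_zero, Finset.sum_const, Finset.card_univ,
    ZMod.card, nsmul_eq_mul, zero_add, lt_irrefl, if_false]
  rw [← Finset.mul_sum, ← Nat.cast_sum, hwk]
  have : (k : ZMod 2) + k = 0 := CharTwo.add_self_eq_zero _
  linear_combination this * (-1 : ZMod 2)

end Inversions

/-! ### The height function and correlations modulo 2. -/

section Height

open Polynomial

/-- Euclid's algorithm on the lengths: reducing b modulo a changes the longer sum by a multiple of
the shorter. -/
theorem isCoprime_geom_sum {R : Type*} [CommRing R] (x : R) {a b : ℕ} (h : Nat.Coprime a b) :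
    IsCoprime (∑ t ∈ Finset.range a, x ^ t) (∑ t ∈ Finset.range b, x ^ t) := by
  have hadd : ∀ r a c : ℕ, ∃ y, ∑ t ∈ Finset.range (r + a * c), x ^ t =
      ∑ t ∈ Finset.range r, x ^ t + (∑ t ∈ Finset.range a, x ^ t) * y := by
    intro r a c
    induction c with
    | zero => exact ⟨0, by simp⟩
    | succ c ih =>
      obtain ⟨y, hy⟩ := ih
      refine ⟨y + x ^ (r + a * c), ?_⟩
      rw [Nat.mul_succ, ← Nat.add_assoc, Finset.sum_range_add, hy]
      simp only [pow_add, ← Finset.mul_sum]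
      ring
  induction a, b using Nat.gcd.induction with
  | H0 n =>
    have : n = 1 := by simpa using h
    subst this
    simpa using isCoprime_one_right
  | H1 m n hm ih =>
    have h' : Nat.Coprime (n % m) m := by
      rw [Nat.Coprime, ← Nat.gcd_rec]; exact h
    obtain ⟨y, hy⟩ := hadd (n % m) m (n / m)
    rw [Nat.mod_add_div] at hy
    rw [hy]
    exact (IsCoprime.add_mul_left_right_iff).2 (ih h').symm

/-- Two functions `f`, `g` on `ZMod p` whose moving sums of lengths `q₁` and `q₂` add up to a
constant derive, up to constants, from a common function `h`. -/
theorem exists_height {p q₁ q₂ : ℕ} (hcop : Nat.Coprime q₁ q₂)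
    (f g : ZMod p → ZMod 2) (k : ZMod 2)
    (hfg : ∀ j, ∑ d ∈ Finset.range q₁, f (j - d) + ∑ d ∈ Finset.range q₂, g (j - d) = k) :
    ∃ (h : ZMod p → ZMod 2) (u v : ZMod 2), u * q₁ + v * q₂ = 1 ∧
      (∀ j, f j = ∑ d ∈ Finset.range q₂, h (j - d) + u * k) ∧
      (∀ j, g j = ∑ d ∈ Finset.range q₁, h (j - d) + v * k) := by
  let S : Module.End (ZMod 2) (ZMod p → ZMod 2) :=
    { toFun := fun f j => f (j - 1), map_add' := fun _ _ => rfl, map_smul' := fun _ _ => rfl }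
  have hSpow : ∀ (d : ℕ) (f : ZMod p → ZMod 2) (j : ZMod p), (S ^ d) f j = f (j - d) := by
    intro d
    induction d with
    | zero => intro f j; simp
    | succ d ih =>
      intro f j
      rw [pow_succ, Module.End.mul_apply, ih]
      change f (j - d - 1) = _
      push_cast
      congr 1; ring
  have hG : ∀ (q : ℕ) (f : ZMod p → ZMod 2) (j : ZMod p),
      (aeval S (∑ t ∈ Finset.range q, (X : (ZMod 2)[X]) ^ t)) f j =
        ∑ d ∈ Finset.range q, f (j - d) := by
    intro q f j
    simp [LinearMap.sum_apply, hSpow]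
  have hconst : ∀ (P : (ZMod 2)[X]) (c : ZMod 2), (aeval S P) (fun _ => c) = fun _ => P.eval 1 * c := by
    intro P c
    induction P using Polynomial.induction_on' with
    | add P Q hP hQ => rw [map_add, LinearMap.add_apply, hP, hQ]; funext; simp [add_mul]
    | monomial n a =>
      funext j
      simp [Polynomial.aeval_monomial, hSpow, Module.algebraMap_end_apply]
  obtain ⟨u, v, huv⟩ := isCoprime_geom_sum (X : (ZMod 2)[X]) hcop
  set G₁ := ∑ t ∈ Finset.range q₁, (X : (ZMod 2)[X]) ^ t with hG₁
  set G₂ := ∑ t ∈ Finset.range q₂, (X : (ZMod 2)[X]) ^ t with hG₂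
  have hrel : aeval S G₁ f + aeval S G₂ g = fun _ => k := by
    funext j
    rw [Pi.add_apply, hG, hG, hfg]
  have hchar : ∀ a b c : ZMod p → ZMod 2, a + b = c → a = c + b ∧ b = c + a := by
    intro a b c habc
    subst habc
    constructor <;> funext j <;> simp only [Pi.add_apply] <;> generalize a j = x <;>
      generalize b j = y <;> revert x y <;> decide
  have hmulapp : ∀ (P Q : (ZMod 2)[X]) (a : ZMod p → ZMod 2),
      aeval S P (aeval S Q a) = aeval S (P * Q) a := by
    intro P Q a; rw [map_mul, Module.End.mul_apply]
  have hone : ∀ a : ZMod p → ZMod 2, a = aeval S (u * G₁) a + aeval S (v * G₂) a := by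
    intro a
    rw [← LinearMap.add_apply, ← map_add, huv, map_one, Module.End.one_apply]
  -- With u G₁ + v G₂ = 1 and G₁ f + G₂ g = k, set h = v f + u g. Then G₂ h = (1 - u G₁) f + u (k -
  -- G₁ f) = f + u(1) k in characteristic 2, and symmetrically for g; a polynomial in `S` acts on
  -- constants by its value at 1.
  refine ⟨aeval S v f + aeval S u g, u.eval 1, v.eval 1, ?_, ?_, ?_⟩
  · have := congrArg (Polynomial.eval 1) huv
    simpa [hG₁, hG₂, eval_finsetSum] using this
  · intro j
    rw [← hG, ← hG₂, map_add, hmulapp, hmulapp, ← hmulapp G₂ u]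
    have h1 := hone f
    rw [← hmulapp u, (hchar _ _ _ hrel).1, map_add, hconst, hmulapp] at h1
    conv_lhs => rw [h1]
    simp only [Pi.add_apply, hmulapp, mul_comm G₂]
    ring
  · intro j
    rw [← hG, ← hG₁, map_add, hmulapp, hmulapp]
    have h1 := hone g
    rw [← hmulapp v, (hchar _ _ _ hrel).2, map_add, hconst, hmulapp] at h1
    conv_lhs => rw [h1]
    simp only [Pi.add_apply, mul_comm G₁]
    ring

/-- Because n + 1 + a = b, the central reflection of the box negates the argument d + 1 + s - t. As
H is even, terms cancel in pairs modulo 2; at a fixed point the argument is 0 and the term H - H 0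
vanishes. -/
theorem sum_autocorrelation_box {p : ℕ} (H : ZMod p → ZMod 2)
    (hH : ∀ n, H (-n) = H n) {n a b : ℕ} (hn : n + 1 + a = b) :
    ∑ d ∈ Finset.range n, ∑ s ∈ Finset.range a, ∑ t ∈ Finset.range b,
      H (((d : ℤ) + 1 + s - t : ℤ) : ZMod p) = n * a * b * H 0 := by
  have h2 : ∀ x y : ZMod 2, x = y → x - y = 0 := fun x y h => by rw [h, sub_self]
  have key : ∑ x ∈ Finset.range n ×ˢ (Finset.range a ×ˢ Finset.range b),
      (H (((x.1 : ℤ) + 1 + x.2.1 - x.2.2 : ℤ) : ZMod p) - H 0) = 0 := by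
    refine Finset.sum_involution
      (fun x _ => (n - 1 - x.1, a - 1 - x.2.1, b - 1 - x.2.2)) ?_ ?_ ?_ ?_
    · rintro ⟨d, s, t⟩ hx
      simp only [Finset.mem_product, Finset.mem_range] at hx
      have : (((n - 1 - d : ℕ) : ℤ) + 1 + ((a - 1 - s : ℕ) : ℤ) - ((b - 1 - t : ℕ) : ℤ)) =
        -((d : ℤ) + 1 + s - t) := by omega
      simp only [this]
      rw [Int.cast_neg, hH]
      exact CharTwo.add_self_eq_zero _
    · rintro ⟨d, s, t⟩ hx hne heq
      simp only [Finset.mem_product, Finset.mem_range, Prod.mk.injEq] at hx heq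
      have : (d : ℤ) + 1 + s - t = 0 := by omega
      simp [this] at hne
    · rintro ⟨d, s, t⟩ hx
      simp only [Finset.mem_product, Finset.mem_range] at hx ⊢
      omega
    · rintro ⟨d, s, t⟩ hx
      simp only [Finset.mem_product, Finset.mem_range, Prod.mk.injEq] at hx ⊢
      omega
  rw [Finset.sum_product] at key
  simp_rw [Finset.sum_product] at key
  simp only [Finset.sum_sub_distrib, Finset.sum_const, Finset.card_range, nsmul_eq_mul] at key
  rw [sub_eq_zero] at key
  rw [key]; ring

end Height

theorem sum_moving_sum {M : Type*} [CommRing M] {p : ℕ} [NeZero p] (h : ZMod p → M) (c : M) (q : ℕ) :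
    ∑ j, (∑ d ∈ Finset.range q, h (j - d) + c) = q * ∑ j, h j + p * c := by
  rw [Finset.sum_add_distrib, Finset.sum_comm]
  have : ∀ d : ℕ, ∑ j : ZMod p, h (j - d) = ∑ j, h j := fun d =>
    Equiv.sum_comp (Equiv.subRight (d : ZMod p)) h
  simp [this]

/-- Expanding the product leaves the autocorrelation of h summed over a box, plus terms linear in
the total of h. The autocorrelation at 0 equals that total because x² = x in ZMod 2. -/
theorem sum_moving_sum_correlation {p : ℕ} [NeZero p] (h : ZMod p → ZMod 2) (α β : ZMod 2)
    {n a b : ℕ} (hn : n + 1 + a = b) :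
    ∑ d ∈ Finset.range n, ∑ i, (∑ s ∈ Finset.range a, h (i - s) + β) *
      (∑ t ∈ Finset.range b, h (i + (d + 1 : ℕ) - t) + α) =
    n * (a * b * ∑ i, h i + α * (a * ∑ i, h i) + β * (b * ∑ i, h i) + p * (α * β)) := by
  let H : ZMod p → ZMod 2 := fun x => ∑ i, h i * h (i + x)
  have hH : ∀ x, H (-x) = H x := by
    intro x
    simp only [H]
    rw [← Equiv.sum_comp (Equiv.addRight x)]
    refine Finset.sum_congr rfl fun i _ => ?_
    simp [mul_comm]
  have hH0 : H 0 = ∑ i, h i := by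
    refine Finset.sum_congr rfl fun i _ => ?_
    rw [add_zero]
    generalize h i = x
    revert x; decide
  have hsum1 : ∀ d : ℕ, ∑ i, (∑ s ∈ Finset.range a, h (i - s)) *
      (∑ t ∈ Finset.range b, h (i + (d + 1 : ℕ) - t)) =
      ∑ s ∈ Finset.range a, ∑ t ∈ Finset.range b, H (((d : ℤ) + 1 + s - t : ℤ) : ZMod p) := by
    intro d
    simp_rw [Finset.sum_mul_sum]
    rw [Finset.sum_comm]
    refine Finset.sum_congr rfl fun s _ => ?_
    rw [Finset.sum_comm]
    refine Finset.sum_congr rfl fun t _ => ?_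
    rw [← Equiv.sum_comp (Equiv.addRight (s : ZMod p))]
    refine Finset.sum_congr rfl fun i _ => ?_
    simp only [Equiv.coe_addRight, add_sub_cancel_right]
    congr 2
    push_cast; ring
  have hA : ∑ i, ∑ s ∈ Finset.range a, h (i - s) = a * ∑ i, h i := by
    simpa using sum_moving_sum h 0 a
  have hB : ∀ d : ℕ, ∑ i, ∑ t ∈ Finset.range b, h (i + (d + 1 : ℕ) - t) = b * ∑ i, h i := by
    intro d
    refine (Equiv.sum_comp (Equiv.addRight ((d + 1 : ℕ) : ZMod p))
      (fun i => ∑ t ∈ Finset.range b, h (i - t))).trans ?_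
    simpa using sum_moving_sum h 0 b
  have hterm : ∀ d : ℕ, ∑ i, (∑ s ∈ Finset.range a, h (i - s) + β) *
      (∑ t ∈ Finset.range b, h (i + (d + 1 : ℕ) - t) + α) =
      ∑ s ∈ Finset.range a, ∑ t ∈ Finset.range b, H (((d : ℤ) + 1 + s - t : ℤ) : ZMod p) +
      (α * (a * ∑ i, h i) + β * (b * ∑ i, h i) + p * (α * β)) := by
    intro d
    rw [← hsum1, ← hA, ← hB d, Finset.mul_sum, Finset.mul_sum]
    have : (p : ZMod 2) * (α * β) = ∑ _i : ZMod p, α * β := by simp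
    rw [this, ← Finset.sum_add_distrib, ← Finset.sum_add_distrib, ← Finset.sum_add_distrib]
    exact Finset.sum_congr rfl fun i _ => by ring
  simp_rw [hterm]
  rw [Finset.sum_add_distrib, sum_autocorrelation_box H hH hn, hH0]
  simp only [Finset.sum_const, Finset.card_range, nsmul_eq_mul]
  ring

/-! ### The sign of a permutation with steps 0, q₁, q₂. -/

section Shift

variable {p q₁ q₂ k : ℕ} [NeZero p] {τ : ZMod p → Fin 3}

theorem sum_ite_eq_typeCount {M : Type*} [AddCommMonoidWithOne M] (τ : ZMod p → Fin 3) (t : Fin 3) :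
    ∑ i, (if τ i = t then 1 else 0 : M) = (typeCount τ t : M) := by
  simp [typeCount]

theorem typeCount_sum (τ : ZMod p → Fin 3) :
    typeCount τ 0 + typeCount τ 1 + typeCount τ 2 = p := by
  have h := Finset.card_eq_sum_card_fiberwise (s := Finset.univ) (t := Finset.univ) (f := τ)
    (fun _ _ => Finset.mem_univ _)
  rw [Fin.sum_univ_three, Finset.card_univ, ZMod.card] at h
  exact h.symm

theorem sum_step (τ : ZMod p → Fin 3) :
    ∑ i, (![0, q₁, q₂] (τ i) : ℕ) = q₁ * typeCount τ 1 + q₂ * typeCount τ 2 := by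
  have h : ∀ i, (![0, q₁, q₂] (τ i) : ℕ) =
      q₁ * (if τ i = 1 then 1 else 0) + q₂ * (if τ i = 2 then 1 else 0) := by
    intro i
    generalize τ i = t
    fin_cases t <;> simp
  simp_rw [h]
  rw [Finset.sum_add_distrib, ← Finset.mul_sum, ← Finset.mul_sum, sum_ite_eq_typeCount,
    sum_ite_eq_typeCount]
  simp

/-- A permutation preserves the sum of all residues, so the steps add up to 0 modulo p. -/
theorem dvd_of_injective (hτ : Function.Injective (shiftMap p q₁ q₂ τ)) :
    p ∣ q₁ * typeCount τ 1 + q₂ * typeCount τ 2 := by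
  rw [← sum_step, ← ZMod.natCast_eq_zero_iff]
  have hb : Function.Bijective (shiftMap p q₁ q₂ τ) := Finite.injective_iff_bijective.1 hτ
  have h := Equiv.sum_comp (Equiv.ofBijective _ hb) (fun i : ZMod p => i)
  simp only [Equiv.ofBijective_apply, shiftMap, Finset.sum_add_distrib] at h
  push_cast
  exact add_eq_left.1 h

/-- Exactly `k` of the arcs `i → i + q (τ i)` pass over any given place. -/
theorem sum_arcs_eq (hτ : Function.Bijective (shiftMap p q₁ q₂ τ))
    (hk : q₁ * typeCount τ 1 + q₂ * typeCount τ 2 = k * p) (j : ZMod p) :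
    ∑ d ∈ Finset.range q₁, (if τ (j - d) = 1 then 1 else 0 : ℤ) +
      ∑ d ∈ Finset.range q₂, (if τ (j - d) = 2 then 1 else 0 : ℤ) = k := by
  set Φ : ZMod p → ℤ := fun j => ∑ d ∈ Finset.range q₁, (if τ (j - d) = 1 then 1 else 0 : ℤ) +
      ∑ d ∈ Finset.range q₂, (if τ (j - d) = 2 then 1 else 0 : ℤ) with hΦ
  have htel : ∀ (F : ZMod p → ℤ) (J : ZMod p) (q : ℕ), ∑ d ∈ Finset.range q, F (J + 1 - d) =
      ∑ d ∈ Finset.range q, F (J - d) + F (J + 1) - F (J + 1 - q) := by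
    intro F J q
    induction q with
    | zero => simp
    | succ q ih =>
      rw [Finset.sum_range_succ, Finset.sum_range_succ, ih]
      have : J + 1 - ((q + 1 : ℕ) : ZMod p) = J - q := by push_cast; ring
      rw [this]; ring
  have hpre : ∀ J : ZMod p, (if τ J = 0 then 1 else 0 : ℤ) + (if τ (J - q₁) = 1 then 1 else 0) +
      (if τ (J - q₂) = 2 then 1 else 0) = 1 := by
    intro J
    have h1 : ∑ i, (if shiftMap p q₁ q₂ τ i = J then 1 else 0 : ℤ) = 1 := by
      obtain ⟨i, hi⟩ := hτ.2 J
      subst hi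
      simp [hτ.1.eq_iff]
    have h2 : ∀ i, (if shiftMap p q₁ q₂ τ i = J then 1 else 0 : ℤ) =
        (if i = J then (if τ i = 0 then 1 else 0) else 0) +
        (if i = J - q₁ then (if τ i = 1 then 1 else 0) else 0) +
        (if i = J - q₂ then (if τ i = 2 then 1 else 0) else 0) := by
      intro i
      have ht : τ i = 0 ∨ τ i = 1 ∨ τ i = 2 := by
        generalize τ i = t
        revert t; decide
      rcases ht with h | h | h <;> simp [shiftMap, eq_sub_iff_add_eq, h]
    simp_rw [h2] at h1
    rw [Finset.sum_add_distrib, Finset.sum_add_distrib] at h1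
    simpa using h1
  -- Passing to J + 1 gains the arc starting there and loses the one ending there; for a fixed point
  -- neither occurs. By `hpre` exactly one step ends at each place.
  have hstep : ∀ J, Φ (J + 1) = Φ J := by
    intro J
    have h0 := hpre (J + 1)
    have h1 : (if τ (J + 1) = 0 then 1 else 0 : ℤ) + (if τ (J + 1) = 1 then 1 else 0) +
        (if τ (J + 1) = 2 then 1 else 0) = 1 := by
      generalize τ (J + 1) = t
      fin_cases t <;> simp
    simp only [hΦ]
    rw [htel (fun i => if τ i = 1 then 1 else 0), htel (fun i => if τ i = 2 then 1 else 0)]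
    linarith
  have hconst : ∀ J, Φ J = Φ 0 := by
    intro J
    rw [← ZMod.natCast_zmod_val J]
    induction J.val with
    | zero => simp
    | succ n ih => rw [Nat.cast_succ, hstep, ih]
  have hsum : ∑ J, Φ J = k * p := by
    simp only [hΦ, Finset.sum_add_distrib]
    have e1 := sum_moving_sum (fun i => if τ i = 1 then (1 : ℤ) else 0) 0 q₁
    have e2 := sum_moving_sum (fun i => if τ i = 2 then (1 : ℤ) else 0) 0 q₂
    simp only [add_zero, mul_zero] at e1 e2
    rw [e1, e2, sum_ite_eq_typeCount, sum_ite_eq_typeCount]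
    exact_mod_cast hk
  rw [Finset.sum_congr rfl fun J _ => hconst J] at hsum
  simp only [Finset.sum_const, Finset.card_univ, ZMod.card, nsmul_eq_mul] at hsum
  have hp : (p : ℤ) ≠ 0 := by exact_mod_cast NeZero.ne p
  change Φ j = k
  rw [hconst]
  rw [mul_comm] at hsum
  exact mul_right_cancel₀ hp hsum

set_option maxRecDepth 100000 in
-- The final comparison in `sum_nested_arcs_eq`, a check over all values in ZMod 2. Here a, b are
-- q₁, q₂ and H is the total of the height function; the last two factors are the numbers of steps
-- q₂ and q₁.
theorem parity_identity : ∀ n a b p k u v H : ZMod 2, u * a + v * b = 1 → n + 1 + a = b →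
    n * (a * b * H + u * k * (a * H) + v * k * (b * H) + p * (u * k * (v * k))) =
      (k + 1) * (b * H + p * (u * k)) * (a * H + p * (v * k)) := by
  decide

/-- Counts long arcs with a short arc nested inside. The offset d = 0 contributes nothing, as one
index has one type; the other q₂ - q₁ - 1 offsets satisfy the box condition. -/
theorem sum_nested_arcs_eq (hle : q₁ ≤ q₂) (hcop : Nat.Coprime q₁ q₂)
    (hτ : Function.Bijective (shiftMap p q₁ q₂ τ))
    (hk : q₁ * typeCount τ 1 + q₂ * typeCount τ 2 = k * p) :
    ∑ d ∈ Finset.range (q₂ - q₁), ∑ i : ZMod p, (if τ i = 2 then 1 else 0 : ZMod 2) *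
      (if τ (i + d) = 1 then 1 else 0) = (k + 1) * typeCount τ 1 * typeCount τ 2 := by
  rcases hle.eq_or_lt with rfl | hlt
  · have h1 : q₁ = 1 := by simpa using hcop
    subst h1
    have hs := typeCount_sum τ
    have hkle : k ≤ 1 := by
      by_contra hcon
      have : 2 * p ≤ k * p := Nat.mul_le_mul_right p (by omega)
      have := NeZero.pos p
      omega
    rw [Nat.sub_self, Finset.range_zero, Finset.sum_empty]
    interval_cases k
    · have : typeCount τ 1 = 0 := by omega
      simp [this]
    · have : ((1 : ℕ) : ZMod 2) + 1 = 0 := by decide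
      rw [this]; simp
  obtain ⟨n, hn⟩ : ∃ n, q₂ - q₁ = n + 1 := ⟨q₂ - q₁ - 1, by omega⟩
  have harcs : ∀ j : ZMod p, ∑ d ∈ Finset.range q₁, (if τ (j - d) = 1 then 1 else 0 : ZMod 2) +
      ∑ d ∈ Finset.range q₂, (if τ (j - d) = 2 then 1 else 0 : ZMod 2) = k := by
    intro j
    have := congrArg (Int.cast : ℤ → ZMod 2) (sum_arcs_eq hτ hk j)
    push_cast at this
    exact this
  obtain ⟨h, u, v, huv, hf, hg⟩ := exists_height hcop (fun j => if τ j = 1 then 1 else 0)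
    (fun j => if τ j = 2 then 1 else 0) (k : ZMod 2) harcs
  rw [hn, Finset.sum_range_succ']
  have h0 : ∑ i : ZMod p, (if τ i = 2 then 1 else 0 : ZMod 2) *
      (if τ (i + (0 : ℕ)) = 1 then 1 else 0) = 0 := by
    refine Finset.sum_eq_zero fun i _ => ?_
    rw [Nat.cast_zero, add_zero]
    generalize τ i = t
    fin_cases t <;> simp
  rw [h0, add_zero]
  have hr : (typeCount τ 1 : ZMod 2) = q₂ * ∑ j, h j + p * (u * k) := by
    rw [← sum_ite_eq_typeCount, ← sum_moving_sum]
    exact Finset.sum_congr rfl fun j _ => hf j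
  have hs : (typeCount τ 2 : ZMod 2) = q₁ * ∑ j, h j + p * (v * k) := by
    rw [← sum_ite_eq_typeCount, ← sum_moving_sum]
    exact Finset.sum_congr rfl fun j _ => hg j
  have hnn : (n : ZMod 2) + 1 + q₁ = q₂ := by
    have : n + 1 + q₁ = q₂ := by omega
    exact_mod_cast congrArg (Nat.cast : ℕ → ZMod 2) this
  have hmain := sum_moving_sum_correlation h (u * k) (v * k) (show n + 1 + q₁ = q₂ by omega)
  simp only [← hf, ← hg] at hmain
  rw [hmain, hr, hs]
  exact parity_identity _ _ _ _ _ _ _ _ huv hnn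

/-- The sign of a permutation of `ZMod p` with displacements in `{0, q₁, q₂}` depends only on the
numbers of displacements of each kind. -/
theorem sign_eq_of_shiftMap (hle : q₁ ≤ q₂) (hcop : Nat.Coprime q₁ q₂) (hp : q₂ < p)
    (σ : Equiv.Perm (ZMod p)) (hσ : ∀ i, σ i = shiftMap p q₁ q₂ τ i)
    (hk : q₁ * typeCount τ 1 + q₂ * typeCount τ 2 = k * p) :
    Equiv.Perm.sign σ = (-1) ^ ((k + 1) * typeCount τ 1 * typeCount τ 2 +
      k * (typeCount τ 1 + typeCount τ 2 + 1)) := by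
  have hτ : Function.Bijective (shiftMap p q₁ q₂ τ) := by
    have : shiftMap p q₁ q₂ τ = σ := funext fun i => (hσ i).symm
    rw [this]; exact σ.bijective
  have hδ : ∀ i, (![0, q₁, q₂] (τ i) : ℕ) < p := by
    intro i
    generalize τ i = t
    fin_cases t <;> simp <;> omega
  have hinv := inversions_eq σ (fun i => (![0, q₁, q₂] (τ i) : ℕ)) hδ hσ ((sum_step τ).trans hk)
  -- Strict nesting leaves three possibilities: a q₂-arc over a q₁-arc, and a q₁- or q₂-arc over a
  -- fixed point.
  have hpt : ∀ i j : ZMod p, (if (j - i).val + (![0, q₁, q₂] (τ j) : ℕ) < (![0, q₁, q₂] (τ i) : ℕ)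
      then 1 else 0 : ZMod 2) =
      (if (j - i).val < q₂ - q₁ then
        (if τ i = 2 then 1 else 0) * (if τ j = 1 then 1 else 0) else 0) +
      ((if (j - i).val < q₁ then (if τ j = 0 then 1 else 0) * (if τ i = 1 then 1 else 0) else 0) +
      (if (j - i).val < q₂ then (if τ j = 0 then 1 else 0) * (if τ i = 2 then 1 else 0) else 0)) := by
    intro i j
    have e : (j - i).val + q₁ < q₂ ↔ (j - i).val < q₂ - q₁ := by omega
    have e' : ¬ ((j - i).val + q₂ < q₁) := by omega
    generalize τ i = s, τ j = t
    fin_cases s <;> fin_cases t <;> simp [e, e']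
  have h1 : ∑ i : ZMod p, ∑ j : ZMod p, (if (j - i).val < q₂ - q₁ then
        (if τ i = 2 then 1 else 0) * (if τ j = 1 then 1 else 0) else 0 : ZMod 2) =
      (k + 1) * typeCount τ 1 * typeCount τ 2 := by
    rw [← sum_nested_arcs_eq hle hcop hτ hk, Finset.sum_comm (s := Finset.range _)]
    refine Finset.sum_congr rfl fun i _ => ?_
    rw [← Equiv.sum_comp (Equiv.addLeft i)]
    simp only [Equiv.coe_addLeft, add_sub_cancel_left]
    exact sum_zmod_ite_val_lt (by omega)
      (fun e => (if τ i = 2 then 1 else 0 : ZMod 2) * (if τ (i + e) = 1 then 1 else 0))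
  have h2 : ∀ (q : ℕ) (_ : q ≤ p) (t : Fin 3) (j : ZMod p), ∑ i : ZMod p, (if (j - i).val < q then
        (if τ j = 0 then 1 else 0) * (if τ i = t then 1 else 0) else 0 : ZMod 2) =
      (if τ j = 0 then 1 else 0) * ∑ d ∈ Finset.range q, (if τ (j - d) = t then 1 else 0) := by
    intro q hq t j
    rw [← Equiv.sum_comp (Equiv.subLeft j), Finset.mul_sum]
    simp only [Equiv.subLeft_apply, sub_sub_cancel]
    exact sum_zmod_ite_val_lt hq
      (fun e => (if τ j = 0 then 1 else 0 : ZMod 2) * (if τ (j - e) = t then 1 else 0))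
  have h3 : ∑ i : ZMod p, ∑ j : ZMod p,
      ((if (j - i).val < q₁ then (if τ j = 0 then 1 else 0) * (if τ i = 1 then 1 else 0) else 0) +
      (if (j - i).val < q₂ then (if τ j = 0 then 1 else 0) * (if τ i = 2 then 1 else 0) else 0) :
        ZMod 2) = typeCount τ 0 * k := by
    rw [Finset.sum_comm, ← sum_ite_eq_typeCount, Finset.sum_mul]
    refine Finset.sum_congr rfl fun j _ => ?_
    rw [Finset.sum_add_distrib, h2 q₁ (by omega), h2 q₂ hp.le, ← mul_add]
    congr 1
    have := congrArg (Int.cast : ℤ → ZMod 2) (sum_arcs_eq hτ hk j)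
    push_cast at this
    exact this
  simp_rw [hpt] at hinv
  simp only [Finset.sum_add_distrib] at hinv h3
  rw [h1, h3] at hinv
  rw [sign_eq_pow_inversions]
  have hpar : ((∑ i, ∑ j, if i.val < j.val ∧ (σ j).val < (σ i).val then 1 else 0 : ℕ) : ZMod 2) =
      (((k + 1) * typeCount τ 1 * typeCount τ 2 +
        k * (typeCount τ 1 + typeCount τ 2 + 1) : ℕ) : ZMod 2) := by
    rw [hinv]
    have hs := congrArg (Nat.cast : ℕ → ZMod 2) (typeCount_sum τ)
    push_cast at hs ⊢
    rw [← hs]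
    have h2 : (2 : ZMod 2) = 0 := by decide
    linear_combination (typeCount τ 0 * k : ZMod 2) * h2
  rw [ZMod.natCast_eq_natCast_iff'] at hpar
  rw [Int.units_pow_eq_pow_mod_two, hpar, ← Int.units_pow_eq_pow_mod_two]

end Shift

/-! ### Existence of a permutation for every admissible (r, s). -/

section Existence

variable {p q₁ q₂ : ℕ} [NeZero p]

theorem val_sub_natCast {X : ℕ} (hX : X ≤ p) (y : ZMod p) :
    ((y - X).val : ℤ) = y.val - X + (if y.val < X then (p : ℤ) else 0) := by
  have hy := ZMod.val_lt y
  by_cases h : y.val < X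
  · have : y - X = ((y.val + p - X : ℕ) : ZMod p) := by
      rw [Nat.cast_sub (by omega)]; simp
    rw [this, ZMod.val_natCast_of_lt (by omega), if_pos h]
    omega
  · have : y - X = ((y.val - X : ℕ) : ZMod p) := by
      rw [Nat.cast_sub (by omega)]; simp
    rw [this, ZMod.val_natCast_of_lt (by omega), if_neg h]
    omega

/-- Translating i by b moves a * i by X, so the sum of the representatives is unchanged; each wrap
adds p and each of the p terms drops by X. No invertibility of a is needed. -/
theorem card_val_mul_lt {X : ℕ} (hX : X ≤ p) {a b : ZMod p} (hab : a * b = X) :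
    (Finset.univ.filter fun i : ZMod p => (a * i).val < X).card = X := by
  have h1 : ∑ i : ZMod p, ((a * i - X).val : ℤ) = ∑ i : ZMod p, ((a * i).val : ℤ) := by
    rw [← Equiv.sum_comp (Equiv.addRight b)]
    refine Finset.sum_congr rfl fun i _ => ?_
    rw [← hab, Equiv.coe_addRight, mul_add, add_sub_cancel_right]
  simp_rw [val_sub_natCast hX] at h1
  rw [Finset.sum_add_distrib, Finset.sum_sub_distrib, ← Finset.sum_filter] at h1
  simp only [Finset.sum_const, Finset.card_univ, ZMod.card, nsmul_eq_mul] at h1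
  have hp : (p : ℤ) ≠ 0 := by exact_mod_cast NeZero.ne p
  have h2 : (((Finset.univ.filter fun i : ZMod p => (a * i).val < X).card : ℤ)) * p = X * p := by
    linarith
  exact_mod_cast mul_right_cancel₀ hp h2

/-- Bézout yields a with a q₁ = s and a q₂ = -r. In the coordinate a * i the map is an interval
exchange: [0, r) moves up by s, [r, r+s) moves down by r, and the rest is fixed. -/
theorem exists_injective_shiftMap (hcop : Nat.Coprime q₁ q₂) {r s : ℕ} (hrs : r + s ≤ p)
    (hdvd : p ∣ q₁ * r + q₂ * s) :
    ∃ τ : ZMod p → Fin 3, Function.Injective (shiftMap p q₁ q₂ τ) ∧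
      typeCount τ 1 = r ∧ typeCount τ 2 = s := by
  have hz : (q₁ : ZMod p) * r + q₂ * s = 0 := by
    have := (ZMod.natCast_eq_zero_iff _ _).2 hdvd
    exact_mod_cast this
  obtain ⟨a, ha1, ha2⟩ : ∃ a : ZMod p, a * q₁ = s ∧ a * q₂ = -r := by
    obtain ⟨u, v, huv⟩ := Nat.isCoprime_iff_coprime.2 hcop
    have huv' : (u : ZMod p) * q₁ + v * q₂ = 1 := by
      exact_mod_cast congrArg (Int.cast : ℤ → ZMod p) huv
    exact ⟨u * s - v * r, by linear_combination (s : ZMod p) * huv' - v * hz,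
      by linear_combination (-(r : ZMod p)) * huv' + u * hz⟩
  let τ : ZMod p → Fin 3 := fun i => if (a * i).val < r then 1 else if (a * i).val < r + s then 2 else 0
  have hmul : ∀ i, ((a * shiftMap p q₁ q₂ τ i).val = (a * i).val + s ∧ τ i = 1 ∧ (a * i).val < r) ∨
      ((a * shiftMap p q₁ q₂ τ i).val + r = (a * i).val ∧ τ i = 2 ∧ (a * i).val < r + s) ∨
      ((a * shiftMap p q₁ q₂ τ i).val = (a * i).val ∧ τ i = 0 ∧ r + s ≤ (a * i).val) := by
    intro i
    by_cases h1 : (a * i).val < r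
    · have ht : τ i = 1 := if_pos h1
      refine Or.inl ⟨?_, ht, h1⟩
      have : a * shiftMap p q₁ q₂ τ i = (((a * i).val + s : ℕ) : ZMod p) := by
        simp [shiftMap, ht, mul_add, ha1]
      rw [this, ZMod.val_natCast_of_lt (by omega)]
    · by_cases h2 : (a * i).val < r + s
      · have ht : τ i = 2 := by simp only [τ, if_neg h1, if_pos h2]
        refine Or.inr (Or.inl ⟨?_, ht, h2⟩)
        have : a * shiftMap p q₁ q₂ τ i = (((a * i).val - r : ℕ) : ZMod p) := by
          rw [Nat.cast_sub (by omega)]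
          simp [shiftMap, ht, mul_add, ha2, sub_eq_add_neg]
        rw [this, ZMod.val_natCast_of_lt (by omega)]
        omega
      · have ht : τ i = 0 := by simp only [τ, if_neg h1, if_neg h2]
        exact Or.inr (Or.inr ⟨by simp [shiftMap, ht], ht, by omega⟩)
  refine ⟨τ, ?_, ?_, ?_⟩
  · intro i j hij
    have hval : (a * shiftMap p q₁ q₂ τ i).val = (a * shiftMap p q₁ q₂ τ j).val := by rw [hij]
    have hi := ZMod.val_lt (a * shiftMap p q₁ q₂ τ i)
    -- Since a may be a zero divisor, a * i does not determine i. The three image intervals are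
    -- disjoint, so equal images force equal steps, and equal steps can be cancelled.
    have hτ : τ i = τ j := by
      rcases hmul i with ⟨e1, t1, b1⟩ | ⟨e1, t1, b1⟩ | ⟨e1, t1, b1⟩ <;>
        rcases hmul j with ⟨e2, t2, b2⟩ | ⟨e2, t2, b2⟩ | ⟨e2, t2, b2⟩ <;>
        first
          | exact t1.trans t2.symm
          | (exfalso; omega)
    simp only [shiftMap, hτ] at hij
    exact add_right_cancel hij
  · have h1 : a * (-q₂) = r := by rw [mul_neg, ha2, neg_neg]
    rw [typeCount]
    conv_rhs => rw [← card_val_mul_lt (by omega) h1]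
    congr 1
    refine Finset.filter_congr fun i _ => ?_
    rcases hmul i with ⟨e1, t1, b1⟩ | ⟨e1, t1, b1⟩ | ⟨e1, t1, b1⟩ <;> rw [t1]
    · simp [b1]
    · have : ¬ (a * i).val < r := by omega
      simp [this]
    · have : ¬ (a * i).val < r := by omega
      simp [this]
  · have h1 : a * (-q₂) = r := by rw [mul_neg, ha2, neg_neg]
    have h2 : a * (q₁ - q₂) = ((r + s : ℕ) : ZMod p) := by
      push_cast
      rw [mul_sub, ha1, ha2]; ring
    have c1 := card_val_mul_lt (by omega) h1
    have c2 := card_val_mul_lt hrs h2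
    have c3 : (Finset.univ.filter fun i : ZMod p => (a * i).val < r + s) =
        (Finset.univ.filter fun i : ZMod p => (a * i).val < r) ∪
        (Finset.univ.filter fun i : ZMod p => τ i = 2) := by
      ext i
      simp only [Finset.mem_filter, Finset.mem_univ, true_and, Finset.mem_union]
      rcases hmul i with ⟨e1, t1, b1⟩ | ⟨e1, t1, b1⟩ | ⟨e1, t1, b1⟩ <;> rw [t1] <;> simp <;> omega
    rw [c3, Finset.card_union_of_disjoint, c1] at c2
    · exact Nat.add_left_cancel c2
    · refine Finset.disjoint_filter.2 fun i _ hi ht => ?_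
      have : τ i = 1 := if_pos hi
      rw [this] at ht
      exact absurd ht (by decide)

end Existence

/-! ### Signs of the coefficients of Φ. -/

section Coefficients

/-- The coefficient of `|z₁|^(2r) |z₂|^(2s)` in `Φ_Γ`, for `Γ = Γ_{p;q₁,q₂}`. -/
def hermCoeff (p q₁ q₂ : ℕ) [NeZero p] (r s : ℕ) : ℤ :=
  (if r = 0 ∧ s = 0 then 1 else 0) - (-1) ^ r * ∑ τ : ZMod p → Fin 3,
    if typeCount τ 1 = r ∧ typeCount τ 2 = s then shiftSign p q₁ q₂ τ else 0

variable {p q₁ q₂ : ℕ} [NeZero p]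

theorem coeff_Phi_Gam_eq_hermCoeff (hcop : Nat.Coprime q₁ q₂) {ω : Circle}
    (hω : IsPrimitiveRoot ω p) (α β : Fin 2 → ℕ) :
    (Phi (Gam ω q₁ q₂)).coeff (biExponent α β) =
      if α = β then (hermCoeff p q₁ q₂ (α 0) (α 1) : ℂ) else 0 := by
  rw [coeff_Phi_Gam hcop hω]
  by_cases h : α = β
  · subst h
    rw [if_pos rfl, hermCoeff, Finset.mul_sum]
    congr 2
    · simp [funext_iff, Fin.forall_fin_two]
    · refine Finset.sum_congr rfl fun τ _ => ?_
      simp [funext_iff, Fin.forall_fin_two, eq_comm]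
  · rw [if_neg h, if_neg (by rintro ⟨rfl, rfl⟩; exact h rfl), Finset.sum_eq_zero]
    · simp
    · intro τ _
      rw [if_neg fun h' => h h'.2.symm]

theorem shiftSign_eq_pow (hle : q₁ ≤ q₂) (hcop : Nat.Coprime q₁ q₂) (hp : q₂ < p)
    {τ : ZMod p → Fin 3} (hτ : Function.Injective (shiftMap p q₁ q₂ τ)) {k : ℕ}
    (hk : q₁ * typeCount τ 1 + q₂ * typeCount τ 2 = k * p) :
    shiftSign p q₁ q₂ τ = (-1) ^ ((k + 1) * typeCount τ 1 * typeCount τ 2 +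
      k * (typeCount τ 1 + typeCount τ 2 + 1)) := by
  rw [shiftSign_eq_sign (Equiv.ofBijective _ (Finite.injective_iff_bijective.1 hτ)) (fun _ => rfl),
    sign_eq_of_shiftMap hle hcop hp _ (fun _ => rfl) hk]
  push_cast
  rfl

theorem hermCoeff_eq_zero {r s : ℕ} (h : ¬ (r + s ≤ p ∧ p ∣ q₁ * r + q₂ * s)) :
    hermCoeff p q₁ q₂ r s = 0 := by
  have h0 : ¬ (r = 0 ∧ s = 0) := by rintro ⟨rfl, rfl⟩; simp at h
  rw [hermCoeff, if_neg h0, Finset.sum_eq_zero]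
  · simp
  · intro τ _
    split_ifs with hτ
    · refine shiftSign_eq_zero fun hinj => h ?_
      obtain ⟨rfl, rfl⟩ := hτ
      have := typeCount_sum τ
      exact ⟨by omega, dvd_of_injective hinj⟩
    · rfl

theorem exists_sum_shiftSign_eq (hle : q₁ ≤ q₂) (hcop : Nat.Coprime q₁ q₂) (hp : q₂ < p)
    {r s k : ℕ} (hrs : r + s ≤ p) (hk : q₁ * r + q₂ * s = k * p) :
    ∃ N : ℕ, 0 < N ∧ (∑ τ : ZMod p → Fin 3,
      if typeCount τ 1 = r ∧ typeCount τ 2 = s then shiftSign p q₁ q₂ τ else 0) =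
      N * (-1) ^ ((k + 1) * r * s + k * (r + s + 1)) := by
  classical
  refine ⟨(Finset.univ.filter fun τ : ZMod p → Fin 3 => Function.Injective (shiftMap p q₁ q₂ τ) ∧
      typeCount τ 1 = r ∧ typeCount τ 2 = s).card, ?_, ?_⟩
  · obtain ⟨τ, hτ⟩ := exists_injective_shiftMap hcop hrs ⟨k, hk.trans (mul_comm _ _)⟩
    exact Finset.card_pos.2 ⟨τ, by simpa using hτ⟩
  · rw [← nsmul_eq_mul, ← Finset.sum_const, Finset.sum_filter]
    refine Finset.sum_congr rfl fun τ _ => ?_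
    by_cases h1 : typeCount τ 1 = r ∧ typeCount τ 2 = s
    · by_cases h2 : Function.Injective (shiftMap p q₁ q₂ τ)
      · rw [if_pos h1, if_pos ⟨h2, h1⟩]
        obtain ⟨rfl, rfl⟩ := h1
        exact shiftSign_eq_pow hle hcop hp h2 hk
      · rw [if_pos h1, if_neg (fun h => h2 h.1), shiftSign_eq_zero h2]
    · rw [if_neg h1, if_neg (fun h => h1 h.2)]

theorem hermCoeff_zero_zero : hermCoeff p q₁ q₂ 0 0 = 0 := by
  have hz : ∀ τ : ZMod p → Fin 3, (typeCount τ 1 = 0 ∧ typeCount τ 2 = 0) ↔ τ = 0 := by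
    intro τ
    simp only [typeCount, Finset.card_eq_zero, Finset.filter_eq_empty_iff, Finset.mem_univ,
      true_imp_iff]
    constructor
    · rintro ⟨h1, h2⟩
      funext i
      have h1 := @h1 i
      have h2 := @h2 i
      change τ i = 0
      generalize τ i = t at *
      revert t; decide
    · rintro rfl
      simp
  have h1 : shiftSign p q₁ q₂ 0 = 1 := by
    rw [shiftSign_eq_sign (Equiv.refl _) (fun i => by simp [shiftMap])]
    simp
  rw [hermCoeff]
  simp only [hz]
  simp [h1]

/-- Together with (-1)^r and the minus sign in front of the product, the exponent is congruent to
(k+1)(r+1)(s+1) + s modulo 2. -/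
theorem hermCoeff_sign (hle : q₁ ≤ q₂) (hcop : Nat.Coprime q₁ q₂) (hp : q₂ < p)
    {r s k : ℕ} (hrs : r + s ≤ p) (hk : q₁ * r + q₂ * s = k * p) (h0 : ¬ (r = 0 ∧ s = 0)) :
    (Even s ∧ (Odd r ∨ Odd k) ∧ 0 < hermCoeff p q₁ q₂ r s) ∨
    (¬ (Even s ∧ (Odd r ∨ Odd k)) ∧ hermCoeff p q₁ q₂ r s < 0) := by
  obtain ⟨N, hN, hsum⟩ := exists_sum_shiftSign_eq hle hcop hp hrs hk
  have hc : hermCoeff p q₁ q₂ r s =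
      (-1) ^ (r + ((k + 1) * r * s + k * (r + s + 1)) + 1) * N := by
    rw [hermCoeff, if_neg h0, hsum]
    ring
  have hN' : (0 : ℤ) < N := by exact_mod_cast hN
  by_cases h : Even s ∧ (Odd r ∨ Odd k)
  · refine Or.inl ⟨h.1, h.2, ?_⟩
    have : Even (r + ((k + 1) * r * s + k * (r + s + 1)) + 1) := by
      obtain ⟨h1, h2⟩ := h
      rcases Nat.even_or_odd r with hr | hr <;> rcases Nat.even_or_odd k with hk' | hk' <;>
        simp_all [parity_simps, ← Nat.not_even_iff_odd]
    rw [hc, this.neg_one_pow, one_mul]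
    exact hN'
  · refine Or.inr ⟨h, ?_⟩
    have : Odd (r + ((k + 1) * r * s + k * (r + s + 1)) + 1) := by
      rcases Nat.even_or_odd r with hr | hr <;> rcases Nat.even_or_odd k with hk' | hk' <;>
        rcases Nat.even_or_odd s with hs | hs <;>
        simp_all [parity_simps, ← Nat.not_even_iff_odd]
    rw [hc, this.neg_one_pow]
    linarith

end Coefficients

/-! ### From eigenvalue counts to counts of coefficients. -/

section Eigenvalues

theorem numPos_diagonal {ι : Type} [Fintype ι] [DecidableEq ι] (d : ι → ℂ) :
    numPos (Matrix.diagonal d) = {i | 0 < (d i).re}.ncard := by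
  classical
  rw [numPos, Matrix.charpoly_diagonal, Polynomial.roots_prod _ _
    (Finset.prod_ne_zero_iff.2 fun i _ => Polynomial.X_sub_C_ne_zero _)]
  simp only [Polynomial.roots_X_sub_C, Multiset.bind_singleton, Multiset.countP_map]
  rw [Set.ncard_eq_toFinset_card', ← Finset.filter_val]
  change Finset.card _ = _
  congr 1
  ext i; simp

theorem numNeg_diagonal {ι : Type} [Fintype ι] [DecidableEq ι] (d : ι → ℂ) :
    numNeg (Matrix.diagonal d) = {i | (d i).re < 0}.ncard := by
  classical
  rw [numNeg, Matrix.charpoly_diagonal, Polynomial.roots_prod _ _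
    (Finset.prod_ne_zero_iff.2 fun i _ => Polynomial.X_sub_C_ne_zero _)]
  simp only [Polynomial.roots_X_sub_C, Multiset.bind_singleton, Multiset.countP_map]
  rw [Set.ncard_eq_toFinset_card', ← Finset.filter_val]
  change Finset.card _ = _
  congr 1
  ext i; simp

variable {p q₁ q₂ : ℕ} [NeZero p]

theorem coeffMatrix_Phi_Gam (hcop : Nat.Coprime q₁ q₂) {ω : Circle} (hω : IsPrimitiveRoot ω p) :
    coeffMatrix (Phi (Gam ω q₁ q₂)) =
      Matrix.diagonal fun α => (hermCoeff p q₁ q₂ (α 0) (α 1) : ℂ) := by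
  ext α β
  rw [coeffMatrix, coeff_Phi_Gam_eq_hermCoeff hcop hω, Matrix.diagonal_apply]
  have : (fun i => (α i : ℕ)) = (fun i => (β i : ℕ)) ↔ α = β := by
    simp [funext_iff, Fin.ext_iff]
  simp only [this]

theorem le_totalDegree_of_hermCoeff_ne_zero (hcop : Nat.Coprime q₁ q₂) {ω : Circle}
    (hω : IsPrimitiveRoot ω p) {r s : ℕ} (h : hermCoeff p q₁ q₂ r s ≠ 0) :
    r ≤ (Phi (Gam ω q₁ q₂)).totalDegree ∧ s ≤ (Phi (Gam ω q₁ q₂)).totalDegree := by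
  have hc := coeff_Phi_Gam_eq_hermCoeff hcop hω ![r, s] ![r, s]
  have hmem : biExponent ![r, s] ![r, s] ∈ (Phi (Gam ω q₁ q₂)).support := by
    rw [MvPolynomial.mem_support_iff, hc]
    simpa using h
  have := MvPolynomial.le_totalDegree hmem
  rw [Finsupp.sum_fintype _ _ (by simp), Fintype.sum_sum_type] at this
  simp [biExponent, Fin.sum_univ_two] at this
  omega

/-- `hP` confines the right-hand set to nonzero coefficients, all of which lie inside the index box
of the matrix. -/
theorem ncard_coeff_eq (hcop : Nat.Coprime q₁ q₂) {ω : Circle} (hω : IsPrimitiveRoot ω p)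
    (P : ℤ → Prop) (hP : ¬ P 0) :
    {α : Fin 2 → Fin ((Phi (Gam ω q₁ q₂)).totalDegree + 1) |
      P (hermCoeff p q₁ q₂ (α 0) (α 1))}.ncard =
    {x : ℕ × ℕ | P (hermCoeff p q₁ q₂ x.1 x.2)}.ncard := by
  refine Set.ncard_congr (fun α _ => ((α 0 : ℕ), (α 1 : ℕ))) (fun α h => h) ?_ ?_
  · intro α β _ _ h
    simp only [Prod.mk.injEq] at h
    funext i
    fin_cases i
    · exact Fin.ext h.1
    · exact Fin.ext h.2
  · rintro ⟨r, s⟩ h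
    have hne : hermCoeff p q₁ q₂ r s ≠ 0 := fun h0 => hP (h0 ▸ h)
    obtain ⟨h1, h2⟩ := le_totalDegree_of_hermCoeff_ne_zero hcop hω hne
    exact ⟨![⟨r, Nat.lt_succ_of_le h1⟩, ⟨s, Nat.lt_succ_of_le h2⟩], by simpa using h, by simp⟩

theorem Npos_Gam (hcop : Nat.Coprime q₁ q₂) {ω : Circle} (hω : IsPrimitiveRoot ω p) :
    Npos (Gam ω q₁ q₂) = {x : ℕ × ℕ | 0 < hermCoeff p q₁ q₂ x.1 x.2}.ncard := by
  rw [Npos, coeffMatrix_Phi_Gam hcop hω, numPos_diagonal,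
    ← ncard_coeff_eq hcop hω (fun c => 0 < c) (lt_irrefl 0)]
  simp

theorem Nneg_Gam (hcop : Nat.Coprime q₁ q₂) {ω : Circle} (hω : IsPrimitiveRoot ω p) :
    Nneg (Gam ω q₁ q₂) = {x : ℕ × ℕ | hermCoeff p q₁ q₂ x.1 x.2 < 0}.ncard := by
  rw [Nneg, coeffMatrix_Phi_Gam hcop hω, numNeg_diagonal,
    ← ncard_coeff_eq hcop hω (fun c => c < 0) (lt_irrefl 0)]
  simp

end Eigenvalues

/-! ### Asymptotic lattice point counts on the segments. -/

section LatticePoints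

/-- The points of `ℕ × ℕ` on the line `q₁ r + q₂ s = k p` with `r + s ≤ p` that satisfy `Q`. -/
def lineSet (q₁ q₂ p k : ℕ) (Q : ℕ → ℕ → Prop) : Set (ℕ × ℕ) :=
  {x | q₁ * x.1 + q₂ * x.2 = k * p ∧ x.1 + x.2 ≤ p ∧ Q x.1 x.2}

theorem ncard_eq_sum_lineSet {q₁ q₂ p : ℕ} (hle : q₁ ≤ q₂) (hp : 0 < p) (Q : ℕ → ℕ → ℕ → Prop) :
    {x : ℕ × ℕ | x.1 + x.2 ≤ p ∧ ∃ k, q₁ * x.1 + q₂ * x.2 = k * p ∧ Q k x.1 x.2}.ncard =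
      ∑ k ∈ Finset.range (q₂ + 1), (lineSet q₁ q₂ p k (Q k)).ncard := by
  classical
  let B := (Finset.range (p + 1) ×ˢ Finset.range (p + 1))
  have hB : ∀ x : ℕ × ℕ, x.1 + x.2 ≤ p → x ∈ B := by
    intro x hx
    simp only [B, Finset.mem_product, Finset.mem_range]
    omega
  have hset : {x : ℕ × ℕ | x.1 + x.2 ≤ p ∧ ∃ k, q₁ * x.1 + q₂ * x.2 = k * p ∧ Q k x.1 x.2} =
      ((B.filter fun x => x.1 + x.2 ≤ p ∧ ∃ k, q₁ * x.1 + q₂ * x.2 = k * p ∧ Q k x.1 x.2 :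
        Finset (ℕ × ℕ)) : Set (ℕ × ℕ)) := by
    ext x
    simp only [Set.mem_ofPred_eq, Finset.coe_filter]
    exact ⟨fun h => ⟨hB x h.1, h⟩, fun h => h.2⟩
  rw [hset, Set.ncard_coe_finset, Finset.card_eq_sum_card_fiberwise
    (f := fun x => (q₁ * x.1 + q₂ * x.2) / p) (t := Finset.range (q₂ + 1))]
  · refine Finset.sum_congr rfl fun k _ => ?_
    rw [← Set.ncard_coe_finset]
    congr 1
    ext x
    simp only [Finset.coe_filter, Finset.mem_filter, Set.mem_ofPred_eq, lineSet]
    constructor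
    · rintro ⟨⟨_, h1, k', h2, h3⟩, h4⟩
      rw [h2, Nat.mul_div_cancel _ hp] at h4
      subst h4
      exact ⟨h2, h1, h3⟩
    · rintro ⟨h1, h2, h3⟩
      exact ⟨⟨hB x h2, h2, k, h1, h3⟩, by rw [h1, Nat.mul_div_cancel _ hp]⟩
  · intro x hx
    simp only [Finset.coe_filter, Set.mem_ofPred_eq] at hx
    simp only [Finset.coe_range, Set.mem_Iio]
    refine Nat.lt_succ_of_le ?_
    have : q₁ * x.1 + q₂ * x.2 ≤ q₂ * p := by nlinarith [hx.2.1]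
    exact (Nat.div_le_div_right this).trans (by rw [Nat.mul_div_cancel _ hp])

/-- The length, in the coordinate `r`, of the segment `q₁ r + q₂ s = k` in the triangle
`r, s ≥ 0`, `r + s ≤ 1`. -/
noncomputable def segmentLength (q₁ q₂ k : ℕ) : ℝ :=
  if k < q₁ then (k : ℝ) / q₁ else if k = q₁ then 1 else ((q₂ : ℝ) - k) / ((q₂ : ℝ) - q₁)

/-- The two bounds on r express s ≥ 0 and r + s ≤ p. The first is the binding one for k < q₁, the
second for k > q₁; for k = q₁ they reduce to r ≤ p, although one of them may be vacuous. -/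
theorem exists_segmentLength_eq {q₁ q₂ k : ℕ} (hle : q₁ ≤ q₂) (hq : 0 < q₂) (hk : k ≤ q₂) :
    ∃ a b : ℕ, 0 < a ∧ segmentLength q₁ q₂ k = (b : ℝ) / a ∧
      ∀ p r : ℕ, (q₁ * r ≤ k * p ∧ (q₂ - q₁) * r ≤ (q₂ - k) * p) ↔ a * r ≤ b * p := by
  obtain ⟨m, rfl⟩ := Nat.exists_eq_add_of_le hle
  rcases lt_trichotomy k q₁ with h | h | h
  · refine ⟨q₁, k, by omega, by simp [segmentLength, h], fun p r => ⟨fun h' => h'.1, fun h' => ⟨h', ?_⟩⟩⟩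
    obtain ⟨d, rfl⟩ := Nat.exists_eq_add_of_lt h
    have e1 : k + d + 1 + m - (k + d + 1) = m := by omega
    have e2 : k + d + 1 + m - k = d + 1 + m := by omega
    rw [e1, e2]
    have h2 : m * ((k + d + 1) * r) ≤ m * (k * p) := Nat.mul_le_mul_left m h'
    have h3 : (k + d + 1) * (m * r) ≤ (k + d + 1) * ((d + 1 + m) * p) := by
      nlinarith [Nat.zero_le (d * m * p), Nat.zero_le (k * d * p), Nat.zero_le (d * d * p),
        Nat.zero_le (d * p), Nat.zero_le (k * p), Nat.zero_le (m * p), Nat.zero_le p]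
    exact Nat.le_of_mul_le_mul_left h3 (by omega)
  · subst h
    refine ⟨1, 1, one_pos, by simp [segmentLength], fun p r => ?_⟩
    have e1 : k + m - k = m := by omega
    rw [e1, one_mul, one_mul]
    constructor
    · rintro ⟨h1, h2⟩
      by_contra hcon
      have hcon : p < r := not_le.1 hcon
      rcases Nat.eq_zero_or_pos k with hk0 | hk0
      · have : m * p < m * r := Nat.mul_lt_mul_of_pos_left hcon (by omega)
        omega
      · have : k * p < k * r := Nat.mul_lt_mul_of_pos_left hcon hk0
        omega
    · exact fun h' => ⟨Nat.mul_le_mul_left _ h', Nat.mul_le_mul_left _ h'⟩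
  · refine ⟨m, q₁ + m - k, by omega, ?_, fun p r => ?_⟩
    · rw [segmentLength, if_neg h.not_gt, if_neg h.ne', Nat.cast_sub hk]
      simp
    · have e1 : q₁ + m - q₁ = m := by omega
      rw [e1]
      refine ⟨fun h' => h'.2, fun h' => ⟨?_, h'⟩⟩
      obtain ⟨c, hc⟩ := Nat.exists_eq_add_of_le hk
      have e2 : q₁ + m - k = c := by omega
      rw [e2] at h'
      have hcm : c ≤ m := by omega
      have h1 : c * p ≤ m * p := Nat.mul_le_mul_right p hcm
      have h2 : r ≤ p := Nat.le_of_mul_le_mul_left (h'.trans h1) (by omega)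
      exact Nat.mul_le_mul h.le h2

/-- The error is at most 2 whatever the residue, which is why the class `c n` may vary with n. -/
theorem tendsto_count_modEq {a b M : ℕ} (ha : 0 < a) (hM : 0 < M) (u c : ℕ → ℕ)
    (hu : Tendsto u atTop atTop) :
    Tendsto (fun n => (((b * u n / a + 1).count (· ≡ c n [MOD M]) : ℕ) : ℝ) / (u n : ℝ)) atTop
      (𝓝 ((b : ℝ) / a / M)) := by
  have huR : Tendsto (fun n => (u n : ℝ)) atTop atTop := tendsto_natCast_atTop_atTop.comp hu
  have hinv : Tendsto (fun n => 2 / (u n : ℝ)) atTop (𝓝 0) :=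
    tendsto_const_nhds.div_atTop huR
  have haR : (0 : ℝ) < a := by exact_mod_cast ha
  have hMR : (0 : ℝ) < M := by exact_mod_cast hM
  have hM1 : (1 : ℝ) ≤ M := by exact_mod_cast hM
  have hbound : ∀ n, |(((b * u n / a + 1).count (· ≡ c n [MOD M]) : ℕ) : ℝ) -
      (b : ℝ) / a / M * u n| ≤ 2 := by
    intro n
    rw [Nat.count_modEq_card _ hM]
    set N := b * u n / a with hN
    have h1 : a * N ≤ b * u n := Nat.mul_div_le _ _
    have h2 : b * u n < a * (N + 1) := by
      exact Nat.lt_mul_div_succ _ ha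
    have h3 : M * ((N + 1) / M) ≤ N + 1 := Nat.mul_div_le _ _
    have h4 : N + 1 < M * ((N + 1) / M + 1) := Nat.lt_mul_div_succ _ hM
    set D := (N + 1) / M with hD
    have h1' : (a : ℝ) * N ≤ b * u n := by exact_mod_cast h1
    have h2' : (b : ℝ) * u n < a * (N + 1) := by exact_mod_cast h2
    have h3' : (M : ℝ) * D ≤ N + 1 := by exact_mod_cast h3
    have h4' : (N : ℝ) + 1 < M * (D + 1) := by exact_mod_cast h4
    set x := (b : ℝ) / a / M * u n with hx
    have hx1 : (a : ℝ) * (M * x) = b * u n := by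
      rw [hx]; field_simp
    have h5 : (N : ℝ) ≤ M * x := by
      refine le_of_mul_le_mul_left ?_ haR
      rw [hx1]; exact h1'
    have h6 : M * x < (N : ℝ) + 1 := by
      refine lt_of_mul_lt_mul_left ?_ haR.le
      rw [hx1]; exact h2'
    have h7 : (D : ℝ) - x ≤ 1 := by
      by_contra hcon
      have : (M : ℝ) * 1 < M * (D - x) := mul_lt_mul_of_pos_left (not_le.1 hcon) hMR
      nlinarith
    have h8 : x - D ≤ 1 := by
      by_contra hcon
      have : (M : ℝ) * 1 < M * (x - D) := mul_lt_mul_of_pos_left (not_le.1 hcon) hMR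
      nlinarith
    rw [abs_le]
    push_cast
    split_ifs <;> constructor <;> linarith
  rw [tendsto_iff_norm_sub_tendsto_zero]
  refine squeeze_zero' (Eventually.of_forall fun n => norm_nonneg _) ?_ hinv
  filter_upwards [hu.eventually_gt_atTop 0] with n hn
  have hnR : (0 : ℝ) < u n := by exact_mod_cast hn
  rw [Real.norm_eq_abs, le_div_iff₀ hnR]
  have := hbound n
  calc _ = |((((b * u n / a + 1).count (· ≡ c n [MOD M]) : ℕ) : ℝ) / (u n : ℝ) -
        (b : ℝ) / a / M) * u n| := by rw [abs_mul, abs_of_pos hnR]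
    _ ≤ 2 := by
      rw [sub_mul, div_mul_cancel₀ _ hnR.ne']; exact this

/-- On the line r determines s, so the points can be counted by r: an interval of integers
intersected with one residue class modulo M. -/
theorem tendsto_ncard_lineSet {q₁ q₂ k M : ℕ} (hle : q₁ ≤ q₂) (hq : 0 < q₂) (hk : k ≤ q₂)
    (hM : 0 < M) {u : ℕ → ℕ} (hu : Tendsto u atTop atTop) (Q : ℕ → ℕ → Prop)
    (h : ∀ n, ∃ c, ∀ r, q₁ * r ≤ k * u n →
      ((∃ s, q₁ * r + q₂ * s = k * u n ∧ Q r s) ↔ r ≡ c [MOD M])) :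
    Tendsto (fun n => ((lineSet q₁ q₂ (u n) k Q).ncard : ℝ) / (u n : ℝ)) atTop
      (𝓝 (segmentLength q₁ q₂ k / M)) := by
  choose c hc using h
  obtain ⟨a, b, ha, hlen, hab⟩ := exists_segmentLength_eq hle hq hk
  rw [hlen]
  have hsum : ∀ p r s : ℕ, q₁ * r + q₂ * s = k * p →
      (r + s ≤ p ↔ (q₂ - q₁) * r ≤ (q₂ - k) * p) := by
    intro p r s hrs
    zify [hle, hk] at hrs ⊢
    have hq' : (0 : ℤ) < q₂ := by exact_mod_cast hq
    have e : ((q₂ : ℤ) - k) * p - (q₂ - q₁) * r = q₂ * (p - (r + s)) := by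
      linear_combination (-1 : ℤ) * hrs * (-1)
    constructor
    · intro h'
      have : (0 : ℤ) ≤ q₂ * (p - (r + s)) := mul_nonneg hq'.le (by linarith)
      linarith
    · intro h'
      have : (0 : ℤ) ≤ q₂ * (p - (r + s)) := by linarith
      have := nonneg_of_mul_nonneg_right this hq'
      linarith
  refine (tendsto_count_modEq (b := b) ha hM u c hu).congr fun n => ?_
  congr 2
  rw [Nat.count_eq_card_filter_range, ← Set.ncard_coe_finset]
  have hinj : Set.InjOn Prod.fst (lineSet q₁ q₂ (u n) k Q) := by
    rintro ⟨r, s⟩ ⟨h1, -⟩ ⟨r', s'⟩ ⟨h2, -⟩ (rfl : r = r')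
    have : q₂ * s = q₂ * s' := by
      simp only at h1 h2
      omega
    rw [Nat.eq_of_mul_eq_mul_left hq this]
  rw [← hinj.ncard_image]
  congr 1
  ext r
  simp only [Finset.coe_filter, Finset.mem_range, Set.mem_ofPred_eq, Set.mem_image, Prod.exists,
    exists_and_right, exists_eq_right, lineSet]
  have hr : r < b * u n / a + 1 ↔ a * r ≤ b * u n := by
    rw [Nat.lt_succ_iff, Nat.le_div_iff_mul_le ha, mul_comm]
  rw [hr, ← hab]
  constructor
  · rintro ⟨⟨h1, h2⟩, h3⟩
    obtain ⟨s, hs, hQ⟩ := (hc n r h1).2 h3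
    exact ⟨s, hs, (hsum _ _ _ hs).2 h2, hQ⟩
  · rintro ⟨s, hs, h2, hQ⟩
    have h1 : q₁ * r ≤ k * u n := by omega
    exact ⟨⟨h1, (hsum _ _ _ hs).1 h2⟩, (hc n r h1).1 ⟨s, hs, hQ⟩⟩

theorem exists_modEq_iff {a M : ℕ} (h : Nat.Coprime a M) (t : ℕ) :
    ∃ c, ∀ r, a * r ≡ t [MOD M] ↔ r ≡ c [MOD M] := by
  rcases Nat.eq_zero_or_pos M with rfl | hM
  · have : a = 1 := by simpa using h
    subst this
    exact ⟨t, fun r => by rw [one_mul]⟩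
  · have : NeZero M := ⟨hM.ne'⟩
    have hinv := ZMod.coe_mul_inv_eq_one a h
    refine ⟨((a : ZMod M)⁻¹ * t).val, fun r => ?_⟩
    rw [← ZMod.natCast_eq_natCast_iff, ← ZMod.natCast_eq_natCast_iff, ZMod.natCast_zmod_val,
      Nat.cast_mul]
    constructor
    · intro h'
      linear_combination (a : ZMod M)⁻¹ * h' - (r : ZMod M) * hinv
    · intro h'
      linear_combination (a : ZMod M) * h' + (t : ZMod M) * hinv

theorem exists_add_mul_eq_iff {a b t : ℕ} (h : a ≤ t) : (∃ s, a + b * s = t) ↔ a ≡ t [MOD b] := by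
  rw [Nat.modEq_iff_dvd' h]
  constructor
  · rintro ⟨s, rfl⟩
    exact ⟨s, by omega⟩
  · rintro ⟨s, hs⟩
    exact ⟨s, by omega⟩

theorem exists_line_iff {q₁ q₂ : ℕ} (hcop : Nat.Coprime q₁ q₂) (t : ℕ) :
    ∃ c, ∀ r, q₁ * r ≤ t → ((∃ s, q₁ * r + q₂ * s = t) ↔ r ≡ c [MOD q₂]) := by
  obtain ⟨c, hc⟩ := exists_modEq_iff hcop t
  exact ⟨c, fun r hr => (exists_add_mul_eq_iff hr).trans (hc r)⟩

theorem exists_line_even_iff {q₁ q₂ : ℕ} (hcop : Nat.Coprime q₁ q₂) (h1 : Odd q₁) (t : ℕ) :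
    ∃ c, ∀ r, q₁ * r ≤ t → ((∃ s, q₁ * r + q₂ * s = t ∧ Even s) ↔ r ≡ c [MOD 2 * q₂]) := by
  -- An even s is 2s', which replaces q₂ by 2q₂; this stays coprime to q₁ because q₁ is odd.
  obtain ⟨c, hc⟩ := exists_line_iff
    (Nat.Coprime.mul_right (Nat.coprime_two_right.2 h1) hcop) t
  refine ⟨c, fun r hr => Iff.trans ?_ (hc r hr)⟩
  constructor
  · rintro ⟨s, hs, s', rfl⟩
    exact ⟨s', by rw [← hs]; ring⟩
  · rintro ⟨s, hs⟩
    exact ⟨s + s, by rw [← hs]; ring, s, rfl⟩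

theorem exists_line_odd_iff {q₁ q₂ : ℕ} (hcop : Nat.Coprime q₁ q₂) (h2 : Odd q₂) (t : ℕ) :
    ∃ c, ∀ r, q₁ * r ≤ t → ((∃ s, q₁ * r + q₂ * s = t ∧ Odd r) ↔ r ≡ c [MOD 2 * q₂]) := by
  obtain ⟨c, hc⟩ := exists_line_iff hcop t
  have hco : Nat.Coprime 2 q₂ := Nat.coprime_two_left.2 h2
  obtain ⟨d, hd1, hd2⟩ := Nat.chineseRemainder hco 1 c
  refine ⟨d, fun r hr => ?_⟩
  rw [← Nat.modEq_and_modEq_iff_modEq_mul hco, exists_and_right, hc r hr, and_comm]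
  refine and_congr ?_ ⟨fun h => h.trans hd2.symm, fun h => h.trans hd2⟩
  have hodd : Odd r ↔ r ≡ 1 [MOD 2] := by rw [Nat.odd_iff, Nat.ModEq]
  rw [hodd]
  exact ⟨fun h => h.trans hd1.symm, fun h => h.trans hd1⟩

end LatticePoints

/-! ### The ratio as a quotient of sums over segments. -/

section Ratio

theorem tendsto_sum_lineSet {q₁ q₂ : ℕ} {u : ℕ → ℕ} (Q : ℕ → ℕ → ℕ → Prop) (L : ℕ → ℝ)
    (h : ∀ k, k ≤ q₂ → Tendsto (fun n => ((lineSet q₁ q₂ (u n) k (Q k)).ncard : ℝ) / (u n : ℝ)) atTop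
      (𝓝 (L k))) :
    Tendsto (fun n => ((∑ k ∈ Finset.range (q₂ + 1), (lineSet q₁ q₂ (u n) k (Q k)).ncard : ℕ) : ℝ) /
      (u n : ℝ)) atTop (𝓝 (∑ k ∈ Finset.range (q₂ + 1), L k)) := by
  simp_rw [Nat.cast_sum, Finset.sum_div]
  exact tendsto_finsetSum _ fun k hk => h k (Nat.lt_succ_iff.1 (Finset.mem_range.1 hk))

theorem Npos_eq_sum {p q₁ q₂ : ℕ} (hle : q₁ ≤ q₂) (hcop : Nat.Coprime q₁ q₂) (hp : q₂ < p)
    {ω : Circle} (hω : IsPrimitiveRoot ω p) :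
    Npos (Gam ω q₁ q₂) = ∑ k ∈ Finset.range (q₂ + 1),
      (lineSet q₁ q₂ p k fun r s => Even s ∧ (Odd r ∨ Odd k)).ncard := by
  have : NeZero p := ⟨by omega⟩
  rw [Npos_Gam hcop hω, ← ncard_eq_sum_lineSet hle (by omega)]
  congr 1
  ext ⟨r, s⟩
  simp only [Set.mem_ofPred_eq]
  constructor
  · intro h
    have hlat : r + s ≤ p ∧ p ∣ q₁ * r + q₂ * s := by
      by_contra hcon
      rw [hermCoeff_eq_zero hcon] at h
      exact lt_irrefl _ h
    obtain ⟨hrs, k, hk⟩ := hlat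
    have h0 : ¬ (r = 0 ∧ s = 0) := by
      rintro ⟨rfl, rfl⟩
      rw [hermCoeff_zero_zero] at h
      exact lt_irrefl _ h
    rw [mul_comm p] at hk
    rcases hermCoeff_sign hle hcop hp hrs hk h0 with h' | h'
    · exact ⟨hrs, k, hk, h'.1, h'.2.1⟩
    · exact absurd h h'.2.not_gt
  · rintro ⟨hrs, k, hk, h1, h2⟩
    have h0 : ¬ (r = 0 ∧ s = 0) := by
      rintro ⟨rfl, rfl⟩
      have : k = 0 := by
        simp only [mul_zero, add_zero] at hk
        rcases mul_eq_zero.1 hk.symm with h | h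
        · exact h
        · omega
      subst this
      simp at h2
    rcases hermCoeff_sign hle hcop hp hrs hk h0 with h' | h'
    · exact h'.2.2
    · exact absurd ⟨h1, h2⟩ h'.1

/-- The extra 1 is the origin: it lies on the line k = 0, but the constant term of Φ vanishes. -/
theorem Npos_add_Nneg_eq_sum {p q₁ q₂ : ℕ} (hle : q₁ ≤ q₂) (hcop : Nat.Coprime q₁ q₂) (hp : q₂ < p)
    {ω : Circle} (hω : IsPrimitiveRoot ω p) :
    Npos (Gam ω q₁ q₂) + Nneg (Gam ω q₁ q₂) + 1 = ∑ k ∈ Finset.range (q₂ + 1),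
      (lineSet q₁ q₂ p k fun _ _ => True).ncard := by
  have : NeZero p := ⟨by omega⟩
  rw [Npos_Gam hcop hω, Nneg_Gam hcop hω, ← ncard_eq_sum_lineSet hle (by omega) fun _ _ _ => True]
  have hfin : {x : ℕ × ℕ | x.1 + x.2 ≤ p}.Finite := by
    refine (Finset.range (p + 1) ×ˢ Finset.range (p + 1)).finite_toSet.subset fun x hx => ?_
    simp only [Set.mem_ofPred_eq] at hx
    simp only [Finset.coe_product, Finset.coe_range, Set.mem_prod, Set.mem_Iio]
    omega
  have hle0 : ∀ r s, hermCoeff p q₁ q₂ r s ≠ 0 → r + s ≤ p ∧ p ∣ q₁ * r + q₂ * s := fun r s h => by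
    by_contra hcon
    exact h (hermCoeff_eq_zero hcon)
  have hf1 : {x : ℕ × ℕ | 0 < hermCoeff p q₁ q₂ x.1 x.2}.Finite :=
    hfin.subset fun x hx => (hle0 _ _ (ne_of_gt hx)).1
  have hf2 : {x : ℕ × ℕ | hermCoeff p q₁ q₂ x.1 x.2 < 0}.Finite :=
    hfin.subset fun x hx => (hle0 _ _ (ne_of_lt hx)).1
  rw [← Set.ncard_union_eq _ hf1 hf2]
  · rw [← Set.ncard_insert_of_notMem (a := ((0, 0) : ℕ × ℕ)) _ (hf1.union hf2)]
    · congr 1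
      ext ⟨r, s⟩
      simp only [Set.mem_ofPred_eq, Set.mem_insert_iff, Set.mem_union, Prod.mk.injEq, and_true]
      constructor
      · rintro (⟨rfl, rfl⟩ | h | h)
        · exact ⟨by omega, 0, by simp⟩
        · obtain ⟨h1, k, hk⟩ := hle0 _ _ (ne_of_gt h)
          exact ⟨h1, k, by rw [hk, mul_comm]⟩
        · obtain ⟨h1, k, hk⟩ := hle0 _ _ (ne_of_lt h)
          exact ⟨h1, k, by rw [hk, mul_comm]⟩
      · rintro ⟨h1, k, hk⟩
        by_cases h0 : r = 0 ∧ s = 0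
        · exact Or.inl h0
        · rcases hermCoeff_sign hle hcop hp h1 hk h0 with h' | h'
          · exact Or.inr (Or.inl h'.2.2)
          · exact Or.inr (Or.inr h'.2)
    · simp [hermCoeff_zero_zero]
  · rw [Set.disjoint_left]
    intro x h1 h2
    exact lt_asymm (show 0 < hermCoeff p q₁ q₂ x.1 x.2 from h1)
      (show hermCoeff p q₁ q₂ x.1 x.2 < 0 from h2)

/-- The limit of the positivity ratio from the limits along the lines `q₁ r + q₂ s = k p`. -/
theorem tendsto_positivityRatio {q₁ q₂ : ℕ} (hle : q₁ ≤ q₂) (hcop : Nat.Coprime q₁ q₂)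
    {ω : ℕ → Circle} (hω : ∀ p : ℕ, 0 < p → IsPrimitiveRoot (ω p) p)
    {u : ℕ → ℕ} (hu : Tendsto u atTop atTop) (L : ℕ → ℝ)
    (h : ∀ k, k ≤ q₂ → Tendsto (fun n => ((lineSet q₁ q₂ (u n) k
      fun r s => Even s ∧ (Odd r ∨ Odd k)).ncard : ℝ) / (u n : ℝ)) atTop (𝓝 (L k)))
    (hT : ∑ k ∈ Finset.range (q₂ + 1), segmentLength q₁ q₂ k ≠ 0) :
    Tendsto (fun n => positivityRatio (Gam (ω (u n)) q₁ q₂)) atTop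
      (𝓝 (q₂ * (∑ k ∈ Finset.range (q₂ + 1), L k) /
        ∑ k ∈ Finset.range (q₂ + 1), segmentLength q₁ q₂ k)) := by
  have hq : 0 < q₂ := by
    rcases Nat.eq_zero_or_pos q₂ with rfl | h
    · have : q₁ = 0 := by omega
      subst this
      simp at hcop
    · exact h
  have hqR : (q₂ : ℝ) ≠ 0 := by exact_mod_cast hq.ne'
  have h1 := tendsto_sum_lineSet (u := u) (fun k r s => Even s ∧ (Odd r ∨ Odd k)) L h
  have h2 := tendsto_sum_lineSet (q₁ := q₁) (q₂ := q₂) (u := u) (fun _ _ _ => True)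
    (fun k => segmentLength q₁ q₂ k / q₂) fun k hk =>
      tendsto_ncard_lineSet hle hq hk hq hu _ fun n => by
        simpa using exists_line_iff hcop (k * u n)
  have huR : Tendsto (fun n => (u n : ℝ)) atTop atTop := tendsto_natCast_atTop_atTop.comp hu
  have h3 : Tendsto (fun n => 1 / (u n : ℝ)) atTop (𝓝 0) := tendsto_const_nhds.div_atTop huR
  have h4 := h2.sub h3
  rw [← Finset.sum_div, sub_zero] at h4
  have h5 := h1.div h4 (div_ne_zero hT hqR)
  have hlim : (∑ k ∈ Finset.range (q₂ + 1), L k) /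
      ((∑ k ∈ Finset.range (q₂ + 1), segmentLength q₁ q₂ k) / q₂) =
      q₂ * (∑ k ∈ Finset.range (q₂ + 1), L k) /
        ∑ k ∈ Finset.range (q₂ + 1), segmentLength q₁ q₂ k := by
    field_simp
  rw [hlim] at h5
  refine h5.congr' ?_
  filter_upwards [hu.eventually_gt_atTop q₂] with n hn
  have hnR : (u n : ℝ) ≠ 0 := by
    have : u n ≠ 0 := by omega
    exact_mod_cast this
  have hω' := hω (u n) (by omega)
  rw [Pi.div_apply, ← Npos_eq_sum hle hcop hn hω', ← Npos_add_Nneg_eq_sum hle hcop hn hω',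
    positivityRatio, ← sub_div, div_div_div_cancel_right₀ hnR, Nat.cast_add _ 1, Nat.cast_one,
    add_sub_cancel_right]

end Ratio

/-! ### Sums of segment lengths. -/

section SegmentSums

/-- As a function of k the length is a tent with peak 1 at k = q₁; the peak is assigned to the
descending side. -/
theorem sum_segmentLength_mul {q₁ m : ℕ} (hm : 0 < m) (F : ℕ → ℝ) :
    ∑ k ∈ Finset.range (q₁ + m + 1), F k * segmentLength q₁ (q₁ + m) k =
      (∑ k ∈ Finset.range q₁, F k * k) / q₁ +
        (∑ j ∈ Finset.range (m + 1), F (q₁ + j) * ((m : ℝ) - j)) / m := by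
  rw [Nat.add_assoc, Finset.sum_range_add, Finset.sum_div, Finset.sum_div]
  congr 1
  · refine Finset.sum_congr rfl fun k hk => ?_
    rw [segmentLength, if_pos (Finset.mem_range.1 hk), mul_div_assoc]
  · refine Finset.sum_congr rfl fun j _ => ?_
    have hmR : (m : ℝ) ≠ 0 := by exact_mod_cast hm.ne'
    rw [segmentLength, if_neg (by omega), mul_div_assoc]
    congr 1
    rcases Nat.eq_zero_or_pos j with rfl | hj
    · simp [hmR]
    · rw [if_neg (by omega)]
      push_cast
      congr 1 <;> ring

theorem sum_range_natCast (n : ℕ) : ∑ k ∈ Finset.range n, (k : ℝ) = n * (n - 1) / 2 := by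
  induction n with
  | zero => simp
  | succ n ih => rw [Finset.sum_range_succ, ih]; push_cast; ring

theorem sum_range_odd (n : ℕ) :
    ∑ k ∈ Finset.range (2 * n), (if Odd k then (1 : ℝ) else 0) * k = (n : ℝ) ^ 2 := by
  induction n with
  | zero => simp
  | succ n ih =>
    have h1 : ¬ Odd (2 * n) := by simp
    have h2 : Odd (2 * n + 1) := ⟨n, rfl⟩
    rw [Nat.mul_succ, Finset.sum_range_succ, Finset.sum_range_succ, ih, if_neg h1, if_pos h2]
    push_cast; ring

theorem sum_range_even_sub (n : ℕ) (c : ℝ) :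
    ∑ j ∈ Finset.range (2 * n), (if Even j then (1 : ℝ) else 0) * (c - j) = n * c - n * (n - 1) := by
  induction n with
  | zero => simp
  | succ n ih =>
    have h1 : Even (2 * n) := by simp
    have h2 : ¬ Even (2 * n + 1) := by simp
    rw [Nat.mul_succ, Finset.sum_range_succ, Finset.sum_range_succ, ih, if_pos h1, if_neg h2]
    push_cast; ring

theorem sum_range_odd_sub (n : ℕ) (c : ℝ) :
    ∑ j ∈ Finset.range (2 * n), (if Odd j then (1 : ℝ) else 0) * (c - j) = n * c - (n : ℝ) ^ 2 := by
  induction n with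
  | zero => simp
  | succ n ih =>
    have h1 : ¬ Odd (2 * n) := by simp
    have h2 : Odd (2 * n + 1) := ⟨n, rfl⟩
    rw [Nat.mul_succ, Finset.sum_range_succ, Finset.sum_range_succ, ih, if_neg h1, if_pos h2]
    push_cast; ring

theorem sum_segmentLength {q₁ m : ℕ} (h1 : 0 < q₁) (hm : 0 < m) :
    ∑ k ∈ Finset.range (q₁ + m + 1), segmentLength q₁ (q₁ + m) k = ((q₁ : ℝ) + m) / 2 := by
  have h := sum_segmentLength_mul (q₁ := q₁) hm (fun _ => 1)
  simp only [one_mul] at h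
  have hmR : (m : ℝ) ≠ 0 := by exact_mod_cast hm.ne'
  have h1R : (q₁ : ℝ) ≠ 0 := by exact_mod_cast h1.ne'
  rw [h, sum_range_natCast, Finset.sum_sub_distrib, sum_range_natCast]
  simp only [Finset.sum_const, Finset.card_range, nsmul_eq_mul]
  push_cast
  field_simp
  ring

/-- The total length of the segments with `k` odd. -/
noncomputable def oddLength (q₁ q₂ : ℕ) : ℝ :=
  ∑ k ∈ Finset.range (q₂ + 1), (if Odd k then (1 : ℝ) else 0) * segmentLength q₁ q₂ k

theorem oddLength_odd_odd {q₁ m : ℕ} (h1 : Odd q₁) (hm : 0 < m) (h2 : Even m) :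
    oddLength q₁ (q₁ + m) = ((q₁ : ℝ) * (q₁ + m) + 1) / (4 * q₁) := by
  rw [oddLength, sum_segmentLength_mul hm]
  have hpar : ∀ j, Odd (q₁ + j) ↔ Even j := fun j => by
    rw [Nat.odd_add]; simp [h1]
  simp only [hpar]
  obtain ⟨a, rfl⟩ := h1
  obtain ⟨b, rfl⟩ := h2
  have hb : (b : ℝ) ≠ 0 := by
    have : b ≠ 0 := by omega
    exact_mod_cast this
  have ha : (2 * (a : ℝ) + 1) ≠ 0 := by positivity
  rw [Finset.sum_range_succ, sum_range_odd, if_neg (by simp), Finset.sum_range_succ, ← two_mul,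
    sum_range_even_sub]
  push_cast
  field_simp
  ring

theorem oddLength_odd_even {q₁ m : ℕ} (h1 : Odd q₁) (h2 : Odd m) :
    oddLength q₁ (q₁ + m) = ((q₁ : ℝ) + m) * (q₁ * m + 1) / (4 * q₁ * m) := by
  rw [oddLength, sum_segmentLength_mul h2.pos]
  have hpar : ∀ j, Odd (q₁ + j) ↔ Even j := fun j => by
    rw [Nat.odd_add]; simp [h1]
  simp only [hpar]
  obtain ⟨a, rfl⟩ := h1
  obtain ⟨b, rfl⟩ := h2
  have ha : (2 * (a : ℝ) + 1) ≠ 0 := by positivity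
  have hb : (2 * (b : ℝ) + 1) ≠ 0 := by positivity
  rw [Finset.sum_range_succ, sum_range_odd, if_neg (by simp),
    show 2 * b + 1 + 1 = 2 * (b + 1) by ring, sum_range_even_sub]
  push_cast
  field_simp
  ring

theorem oddLength_even_odd {q₁ m : ℕ} (h1 : Even q₁) (hq : 0 < q₁) (h2 : Odd m) :
    oddLength q₁ (q₁ + m) = (((q₁ : ℝ) + m) * m - 1) / (4 * m) := by
  rw [oddLength, sum_segmentLength_mul h2.pos]
  have hpar : ∀ j, Odd (q₁ + j) ↔ Odd j := fun j => by
    rw [Nat.odd_add']; simp [h1]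
  simp only [hpar]
  obtain ⟨a, rfl⟩ := h1
  obtain ⟨b, rfl⟩ := h2
  have ha : (a : ℝ) ≠ 0 := by
    have : a ≠ 0 := by omega
    exact_mod_cast this
  have hb : (2 * (b : ℝ) + 1) ≠ 0 := by positivity
  rw [← two_mul, sum_range_odd,
    show 2 * b + 1 + 1 = 2 * (b + 1) by ring, sum_range_odd_sub]
  push_cast
  field_simp
  ring

end SegmentSums

/-! ### Parity weights on each segment. -/

section LineLimits

variable {q₁ q₂ k : ℕ}

theorem tendsto_lineSet_of_isEmpty {u : ℕ → ℕ} {Q : ℕ → ℕ → Prop}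
    (h : ∀ n r s, q₁ * r + q₂ * s = k * u n → ¬ Q r s) :
    Tendsto (fun n => ((lineSet q₁ q₂ (u n) k Q).ncard : ℝ) / (u n : ℝ)) atTop (𝓝 0) := by
  have : ∀ n, lineSet q₁ q₂ (u n) k Q = ∅ := fun n =>
    Set.eq_empty_of_forall_notMem fun x hx => h n _ _ hx.1 hx.2.2
  simp [this]

theorem lineSet_congr {p : ℕ} {Q Q' : ℕ → ℕ → Prop}
    (h : ∀ r s, q₁ * r + q₂ * s = k * p → (Q r s ↔ Q' r s)) :
    lineSet q₁ q₂ p k Q = lineSet q₁ q₂ p k Q' := by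
  ext x
  exact and_congr_right fun hx => and_congr_right fun _ => h _ _ hx

/-- For k even, s even and r odd would make q₁r + q₂s odd, against kp. So only odd k contribute,
with s even as the sole condition. -/
theorem tendsto_lineSet_odd (hle : q₁ ≤ q₂) (hcop : Nat.Coprime q₁ q₂) (h1 : Odd q₁)
    {u : ℕ → ℕ} (hu : Tendsto u atTop atTop) (hk : k ≤ q₂) :
    Tendsto (fun n => ((lineSet q₁ q₂ (u n) k fun r s => Even s ∧ (Odd r ∨ Odd k)).ncard : ℝ) /
      (u n : ℝ)) atTop (𝓝 ((if Odd k then 1 else 0) * segmentLength q₁ q₂ k / (2 * q₂ : ℕ))) := by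
  have hq : 0 < q₂ := h1.pos.trans_le hle
  by_cases hko : Odd k
  · rw [if_pos hko, one_mul]
    simp only [hko, or_true, and_true]
    exact tendsto_ncard_lineSet hle hq hk (by omega) hu _ fun n => exists_line_even_iff hcop h1 _
  · rw [if_neg hko, zero_mul, zero_div]
    refine tendsto_lineSet_of_isEmpty fun n r s h hQ => ?_
    have hr : Odd r := hQ.2.resolve_right hko
    have h3 : Odd (q₁ * r + q₂ * s) := (h1.mul hr).add_even (hQ.1.mul_left _)
    rw [h] at h3
    exact hko (Nat.odd_mul.1 h3).1

/-- Here s ≡ kp ≡ k modulo 2, so only even k contribute, with r odd as the sole condition. -/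
theorem tendsto_lineSet_even_odd (hle : q₁ ≤ q₂) (hcop : Nat.Coprime q₁ q₂) (h1 : Even q₁)
    (h2 : Odd q₂) {u : ℕ → ℕ} (hu : Tendsto u atTop atTop) (hodd : ∀ n, Odd (u n)) (hk : k ≤ q₂) :
    Tendsto (fun n => ((lineSet q₁ q₂ (u n) k fun r s => Even s ∧ (Odd r ∨ Odd k)).ncard : ℝ) /
      (u n : ℝ)) atTop
      (𝓝 ((1 - (if Odd k then 1 else 0)) * segmentLength q₁ q₂ k / (2 * q₂ : ℕ))) := by
  have hpar : ∀ n r s, q₁ * r + q₂ * s = k * u n → (Even s ↔ Even k) := by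
    intro n r s h
    have := congrArg Even h
    simpa [parity_simps, h1, ← Nat.not_even_iff_odd, Nat.not_even_iff_odd.2 h2,
      Nat.not_even_iff_odd.2 (hodd n)] using this
  by_cases hko : Odd k
  · rw [if_pos hko, sub_self, zero_mul, zero_div]
    refine tendsto_lineSet_of_isEmpty fun n r s h hQ => ?_
    exact Nat.not_even_iff_odd.2 hko ((hpar n r s h).1 hQ.1)
  · rw [if_neg hko, sub_zero, one_mul]
    have hke : Even k := Nat.not_odd_iff_even.1 hko
    refine (tendsto_ncard_lineSet hle h2.pos hk (by have := h2.pos; omega) hu _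
      fun n => exists_line_odd_iff hcop h2 _).congr fun n => ?_
    rw [lineSet_congr (Q := fun r s => Even s ∧ (Odd r ∨ Odd k)) (Q' := fun r _ => Odd r)]
    intro r s h
    simp [hko, (hpar n r s h).2 hke]

/-- Here s is always even. For odd k every point counts, for even k only those with r odd, whence
the weights 2 and 1. -/
theorem tendsto_lineSet_even_even (hle : q₁ ≤ q₂) (hcop : Nat.Coprime q₁ q₂) (h1 : Even q₁)
    (h2 : Odd q₂) {u : ℕ → ℕ} (hu : Tendsto u atTop atTop) (heven : ∀ n, Even (u n)) (hk : k ≤ q₂) :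
    Tendsto (fun n => ((lineSet q₁ q₂ (u n) k fun r s => Even s ∧ (Odd r ∨ Odd k)).ncard : ℝ) /
      (u n : ℝ)) atTop
      (𝓝 ((1 + (if Odd k then 1 else 0)) * segmentLength q₁ q₂ k / (2 * q₂ : ℕ))) := by
  have hpar : ∀ n r s, q₁ * r + q₂ * s = k * u n → Even s := by
    intro n r s h
    have := congrArg Even h
    simpa [parity_simps, h1, Nat.not_even_iff_odd.2 h2, heven n] using this
  by_cases hko : Odd k
  · have e : (1 + (if Odd k then (1 : ℝ) else 0)) * segmentLength q₁ q₂ k / (2 * q₂ : ℕ) =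
        segmentLength q₁ q₂ k / q₂ := by
      have : (q₂ : ℝ) ≠ 0 := by exact_mod_cast h2.pos.ne'
      rw [if_pos hko]; push_cast; field_simp; ring
    rw [e]
    refine (tendsto_ncard_lineSet hle h2.pos hk h2.pos hu (fun _ _ => True) fun n => by
      simpa using exists_line_iff hcop (k * u n)).congr fun n => ?_
    rw [lineSet_congr (Q := fun r s => Even s ∧ (Odd r ∨ Odd k)) (Q' := fun _ _ => True)]
    intro r s h
    simp [hko, hpar n r s h]
  · rw [if_neg hko, add_zero, one_mul]
    refine (tendsto_ncard_lineSet hle h2.pos hk (by have := h2.pos; omega) hu _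
      fun n => exists_line_odd_iff hcop h2 _).congr fun n => ?_
    rw [lineSet_congr (Q := fun r s => Even s ∧ (Odd r ∨ Odd k)) (Q' := fun r _ => Odd r)]
    intro r s h
    simp [hko, hpar n r s h]

end LineLimits

/-! ### Assembling the limits. -/

section Limits

theorem tendsto_positivityRatio_of_weights {q₁ q₂ : ℕ} (hle : q₁ ≤ q₂) (hcop : Nat.Coprime q₁ q₂)
    {ω : ℕ → Circle} (hω : ∀ p : ℕ, 0 < p → IsPrimitiveRoot (ω p) p)
    {u : ℕ → ℕ} (hu : Tendsto u atTop atTop) (w : ℕ → ℝ)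
    (h : ∀ k, k ≤ q₂ → Tendsto (fun n => ((lineSet q₁ q₂ (u n) k
      fun r s => Even s ∧ (Odd r ∨ Odd k)).ncard : ℝ) / (u n : ℝ)) atTop
        (𝓝 (w k * segmentLength q₁ q₂ k / (2 * q₂ : ℕ))))
    {T W l : ℝ} (hT : ∑ k ∈ Finset.range (q₂ + 1), segmentLength q₁ q₂ k = T) (hT0 : T ≠ 0)
    (hW : ∑ k ∈ Finset.range (q₂ + 1), w k * segmentLength q₁ q₂ k = W)
    (hl : W / (2 * T) = l) :
    Tendsto (fun n => positivityRatio (Gam (ω (u n)) q₁ q₂)) atTop (𝓝 l) := by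
  subst hl
  have hq : q₂ ≠ 0 := by
    rintro rfl
    have : q₁ = 0 := by omega
    subst this
    simp at hcop
  have hqR : (q₂ : ℝ) ≠ 0 := by exact_mod_cast hq
  have := tendsto_positivityRatio hle hcop hω hu _ h (by rwa [hT])
  convert this using 2
  rw [hT, ← Finset.sum_div, hW]
  push_cast
  field_simp

end Limits

end HyperquadricCR

open HyperquadricCR in
theorem theorem3 (q₁ q₂ : ℕ) (hle : q₁ ≤ q₂) (hcop : Nat.Coprime q₁ q₂)
    (ω : ℕ → Circle) (hω : ∀ p : ℕ, 0 < p → IsPrimitiveRoot (ω p) p) :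
    (Odd q₁ → Odd q₂ →
      Tendsto (fun p : ℕ => positivityRatio (Gam (ω p) q₁ q₂)) atTop
        (𝓝 (((q₁ : ℝ) * q₂ + 1) / (4 * q₁ * q₂)))) ∧
    (Odd q₁ → Even q₂ →
      Tendsto (fun p : ℕ => positivityRatio (Gam (ω p) q₁ q₂)) atTop
        (𝓝 (((q₁ : ℝ) * ((q₂ : ℝ) - q₁) + 1) / (4 * q₁ * ((q₂ : ℝ) - q₁))))) ∧
    (Even q₁ → Odd q₂ →
      Tendsto (fun n : ℕ => positivityRatio (Gam (ω (2 * n + 1)) q₁ q₂)) atTop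
        (𝓝 (((q₂ : ℝ) * ((q₂ : ℝ) - q₁) + 1) / (4 * q₂ * ((q₂ : ℝ) - q₁)))) ∧
      Tendsto (fun n : ℕ => positivityRatio (Gam (ω (2 * n)) q₁ q₂)) atTop
        (𝓝 ((3 * (q₂ : ℝ) * ((q₂ : ℝ) - q₁) - 1) / (4 * q₂ * ((q₂ : ℝ) - q₁))))) := by
  obtain ⟨m, rfl⟩ := Nat.exists_eq_add_of_le hle
  refine ⟨fun h1 h2 => ?_, fun h1 h2 => ?_, fun h1 h2 => ?_⟩
  · have hlim := fun k hk => tendsto_lineSet_odd (k := k) hle hcop h1 tendsto_id hk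
    have h1R : (q₁ : ℝ) ≠ 0 := by exact_mod_cast h1.pos.ne'
    rcases Nat.eq_zero_or_pos m with rfl | hm
    -- For q₁ = q₂ = 1 the tent has no descending side and `sum_segmentLength` does not apply: the
    -- total length is 1, not q₂/2.
    · have : q₁ = 1 := by simpa using hcop
      subst this
      refine tendsto_positivityRatio_of_weights hle hcop hω tendsto_id _ hlim
        (T := 1) (W := 1) ?_ one_ne_zero ?_ ?_
      · simp [Finset.sum_range_succ, segmentLength]
      · simp [Finset.sum_range_succ, segmentLength]
      · norm_num
    · have hme : Even m := by
        rw [Nat.odd_add] at h2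
        exact h2.1 h1
      have hs : ((q₁ : ℝ) + m) ≠ 0 := by positivity
      refine tendsto_positivityRatio_of_weights hle hcop hω tendsto_id _ hlim
        (sum_segmentLength h1.pos hm) (by positivity) (oddLength_odd_odd h1 hm hme) ?_
      push_cast
      field_simp
  · have hlim := fun k hk => tendsto_lineSet_odd (k := k) hle hcop h1 tendsto_id hk
    have h1R : (q₁ : ℝ) ≠ 0 := by exact_mod_cast h1.pos.ne'
    have hmo : Odd m := by
      rw [Nat.even_add'] at h2
      exact h2.1 h1
    have hmR : (m : ℝ) ≠ 0 := by exact_mod_cast hmo.pos.ne'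
    have hs : ((q₁ : ℝ) + m) ≠ 0 := by positivity
    refine tendsto_positivityRatio_of_weights hle hcop hω tendsto_id _ hlim
      (sum_segmentLength h1.pos hmo.pos) (by positivity) (oddLength_odd_even h1 hmo) ?_
    push_cast
    rw [add_sub_cancel_left]
    field_simp
  · have hu1 : Tendsto (fun n : ℕ => 2 * n + 1) atTop atTop :=
      tendsto_atTop_mono (fun n => by simp only [id]; omega) tendsto_id
    have hu2 : Tendsto (fun n : ℕ => 2 * n) atTop atTop :=
      tendsto_atTop_mono (fun n => by simp only [id]; omega) tendsto_id
    have hlim1 := fun k hk => tendsto_lineSet_even_odd (k := k) hle hcop h1 h2 hu1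
      (fun n => ⟨n, rfl⟩) hk
    have hlim2 := fun k hk => tendsto_lineSet_even_even (k := k) hle hcop h1 h2 hu2
      (fun n => ⟨n, two_mul n⟩) hk
    rcases Nat.eq_zero_or_pos q₁ with rfl | hq
    -- For q₁ = 0, q₂ = 1 the tent has no ascending side, and again the total length is 1.
    · have : m = 1 := by simpa using hcop
      subst this
      constructor
      · refine tendsto_positivityRatio_of_weights hle hcop hω hu1 _ hlim1
          (T := 1) (W := 1) ?_ one_ne_zero ?_ ?_
        · simp [Finset.sum_range_succ, segmentLength]
        · simp [Finset.sum_range_succ, segmentLength]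
        · norm_num
      · refine tendsto_positivityRatio_of_weights hle hcop hω hu2 _ hlim2
          (T := 1) (W := 1) ?_ one_ne_zero ?_ ?_
        · simp [Finset.sum_range_succ, segmentLength]
        · simp [Finset.sum_range_succ, segmentLength]
        · norm_num
    · have hmo : Odd m := by
        rw [Nat.odd_add'] at h2
        exact h2.2 h1
      have hmR : (m : ℝ) ≠ 0 := by exact_mod_cast hmo.pos.ne'
      have hs : ((q₁ : ℝ) + m) ≠ 0 := by positivity
      have hT := sum_segmentLength hq hmo.pos
      have hO := oddLength_even_odd h1 hq hmo
      rw [oddLength] at hO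
      constructor
      · refine tendsto_positivityRatio_of_weights hle hcop hω hu1 _ hlim1 hT (by positivity)
          -- The weight 1 - [k odd] gives the total length minus the odd length; along even orders
          -- the sign is plus.
          (W := ((q₁ : ℝ) + m) / 2 - (((q₁ : ℝ) + m) * m - 1) / (4 * m)) ?_ ?_
        · simp_rw [sub_mul, one_mul]
          rw [Finset.sum_sub_distrib, hT, hO]
        · push_cast
          rw [add_sub_cancel_left]
          field_simp
          ring
      · refine tendsto_positivityRatio_of_weights hle hcop hω hu2 _ hlim2 hT (by positivity)
          (W := ((q₁ : ℝ) + m) / 2 + (((q₁ : ℝ) + m) * m - 1) / (4 * m)) ?_ ?_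
        · simp_rw [add_mul (1 : ℝ), one_mul]
          rw [Finset.sum_add_distrib, hT, hO]
        · push_cast
          rw [add_sub_cancel_left]
          field_simp
          ring
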